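/- Fix an integer $N\ge 1$. Let $\mathbb{C}P^N$ carry the Fubini--Study metric, normalized so that a holomorphic curve $f=[f_0:\dots:f_N]\colon\mathbb{C}\to\mathbb{C}P^N$ (with $f_i$ holomorphic without common zeros) has local Lipschitz constant $|df|(z)\ge 0$ given by \[ |df|^2(z)=\frac{1}{4\pi}\left(\frac{\partial^2}{\partial x^2}+\frac{\partial^2}{\partial y^2}\right)\log\left(|f_0(z)|^2+\dots+|f_N(z)|^2\right),\qquad z=x+y\sqrt{-1}, \] and let $d_{\mathrm{FS}}$ be the induced distance function, that is $d_{\mathrm{FS}}([x],[y])=\frac{1}{\sqrt{\pi}}\arccos\frac{|\langle x,y\rangle|}{\|x\|\,\|y\|}$. For $\lambda>0$ let $\mathcal{B}^N_\lambda$ be the set of holomorphic maps $f\colon\mathbb{C}\to\mathbb{C}P^N$ with $|df|(z)\le\lambda$ for all $z\in\mathbb{C}$, and let $\mathcal{B}^N=\mathcal{B}^N_1$ (the Brody curves). Put $\mathbf{d}_{\mathbb{C}}(f,g)=\sup_{z\in\mathbb{C}}d_{\mathrm{FS}}(f(z),g(z))$ and, for $f\in\mathcal{B}^N$ and $r>0$,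 $B_r(f,\mathbf{d}_{\mathbb{C}})=\{g\in\mathcal{B}^N\mid \mathbf{d}_{\mathbb{C}}(f,g)\le r\}$. For $R>0$, a holomorphic map $f\colon\mathbb{C}\to\mathbb{C}P^N$ is called $R$-nondegenerate if $\max_{|z-a|\le R}|df|(z)\ge 1/R$ for every $a\in\mathbb{C}$. There exist constants $\delta_2>0$ and $C_3>1$, and for every $\eta>0$ a constant $R_1=R_1(\eta)>0$ (so $\delta_2$ and $C_3$ do not depend on $\eta$), such that for every Brody curve $f\in\mathcal{B}^N$ there exists a map $\Phi\colon B_{\delta_2}(f,\mathbf{d}_{\mathbb{C}})\to\mathcal{B}^N_{1+\eta}$ satisfying the following three conditions. \begin{enumerate} \item $\Phi(f)$ is $R_1$-nondegenerate. \item For any $g_1,g_2\in B_{\delta_2}(f,\mathbf{d}_{\mathbb{C}})$ and $z\in\mathbb{C}$ we have \[ d_{\mathrm{FS}}\left(\Phi(g_1)(z),\Phi(g_2)(z)\right)\le C_3\,d_{\mathrm{FS}}\left(g_1(z),g_2(z)\right), \] \[ d_{\mathrm{FS}}\left(g_1(z),g_2(z)\right)\le C_3\sup_{|w-z|\le 3}d_{\mathrm{FS}}\left(\Phi(g_1)(w),\Phi(g_2)(w)\right).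 \] In particular, the image of $\Phi$ is contained in $\{g\in\mathcal{B}^N_{1+\eta}\mid \mathbf{d}_{\mathbb{C}}(\Phi(f),g)\le C_3\delta_2\}$. \item For any square $S\subset\mathbb{C}$ (with sides in arbitrary directions) of side length $L\ge R_1$, \[ \left|\int_S|df|^2\,dxdy-\int_S|d\Phi(f)|^2\,dxdy\right|<\eta L^2. \] \end{enumerate} -/

import Mathlib

open Filter Topology MeasureTheory

noncomputable section

namespace Brody

/-- The Hermitian space `ℂ^(N+1)` of homogeneous coordinates. -/
abbrev HomCoord (N : ℕ) : Type := EuclideanSpace ℂ (Fin (N + 1))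

/-- The complex projective space `ℂP^N`. -/
abbrev CP (N : ℕ) : Type := Projectivization ℂ (HomCoord N)

/-! ### The Fubini–Study metric, normalised so that a projective line has area one -/

/-- The component of `v` orthogonal to the complex line through `x`. -/
def orthPart {N : ℕ} (x v : HomCoord N) : HomCoord N :=
  v - (inner ℂ x v / (‖x‖ : ℂ) ^ 2) • x

/-- The Fubini–Study length of the tangent vector of `ℂP^N` at `[x]` that is the image of
`v ∈ T_x ℂ^(N+1) = ℂ^(N+1)` under the differential of the projection `x ↦ [x]`. -/
def fsNorm {N : ℕ} (x v : HomCoord N) : ℝ :=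
  ‖orthPart x v‖ / (Real.sqrt Real.pi * ‖x‖)

/-- The Fubini–Study distance between `[x]` and `[y]`, in homogeneous coordinates. -/
def fsDistCoord {N : ℕ} (x y : HomCoord N) : ℝ :=
  Real.arccos (‖(inner ℂ x y : ℂ)‖ / (‖x‖ * ‖y‖)) / Real.sqrt Real.pi

/-- The Fubini–Study distance function on `ℂP^N`. -/
def dFS {N : ℕ} (p q : CP N) : ℝ := fsDistCoord p.rep q.rep

theorem fsDistCoord_smul {N : ℕ} (x y : HomCoord N) (a b : ℂ) (ha : a ≠ 0) (hb : b ≠ 0) :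
    fsDistCoord (a • x) (b • y) = fsDistCoord x y := by
  unfold fsDistCoord
  have ha' : ‖a‖ ≠ 0 := norm_ne_zero_iff.2 ha
  have hb' : ‖b‖ ≠ 0 := norm_ne_zero_iff.2 hb
  congr 2
  rw [inner_smul_left, inner_smul_right, norm_mul, norm_mul, norm_smul, norm_smul,
    RCLike.norm_conj]
  rw [show ‖a‖ * (‖b‖ * ‖(inner ℂ x y : ℂ)‖) = (‖a‖ * ‖b‖) * ‖(inner ℂ x y : ℂ)‖ by ring,
    show ‖a‖ * ‖x‖ * (‖b‖ * ‖y‖) = (‖a‖ * ‖b‖) * (‖x‖ * ‖y‖) by ring,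
    mul_div_mul_left _ _ (mul_ne_zero ha' hb')]

/-- The distance does not depend on the choice of homogeneous coordinates. -/
theorem dFS_mk {N : ℕ} (x y : HomCoord N) (hx : x ≠ 0) (hy : y ≠ 0) :
    dFS (Projectivization.mk ℂ x hx) (Projectivization.mk ℂ y hy) = fsDistCoord x y := by
  obtain ⟨a, ha⟩ := Projectivization.exists_smul_eq_mk_rep ℂ x hx
  obtain ⟨b, hb⟩ := Projectivization.exists_smul_eq_mk_rep ℂ y hy
  unfold dFS
  rw [← ha, ← hb]
  exact fsDistCoord_smul x y a b a.ne_zero b.ne_zero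

theorem dFS_self {N : ℕ} (p : CP N) : dFS p p = 0 := by
  have h : ‖p.rep‖ ≠ 0 := norm_ne_zero_iff.2 p.rep_nonzero
  unfold dFS fsDistCoord
  rw [inner_self_eq_norm_sq_to_K]
  have : ‖(((‖p.rep‖ : ℝ) : ℂ)) ^ 2‖ / (‖p.rep‖ * ‖p.rep‖) = 1 := by
    rw [norm_pow, Complex.norm_real, norm_norm]
    field_simp
  erw [this]
  simp

/-! ### Holomorphic curves and their local Lipschitz constant -/

/-- `F` is a holomorphic lift of `f : ℂ → ℂP^N` to homogeneous coordinates near `z`. -/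
def IsLiftAt {N : ℕ} (f : ℂ → CP N) (z : ℂ) (F : ℂ → HomCoord N) : Prop :=
  AnalyticAt ℂ F z ∧ ∀ᶠ w in 𝓝 z, ∃ h : F w ≠ 0, f w = Projectivization.mk ℂ (F w) h

/-- `f : ℂ → ℂP^N` is holomorphic: near every point it is given by
`[f_0(z) : ⋯ : f_N(z)]` with holomorphic functions `f_i` that have no common zero. -/
def IsHolomorphicCurve {N : ℕ} (f : ℂ → CP N) : Prop :=
  ∀ z : ℂ, ∃ F : ℂ → HomCoord N, IsLiftAt f z F

open Classical in
/-- The local Lipschitz constant `|df|(z)`: the Fubini–Study length of `df(v)` for a unit tangent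
vector `v` at `z`. It is computed with a holomorphic lift near `z`, whose choice does not matter
by `speed_eq` (the value `0` is used where there is no such lift). -/
def speed {N : ℕ} (f : ℂ → CP N) (z : ℂ) : ℝ :=
  if h : ∃ F : ℂ → HomCoord N, IsLiftAt f z F then fsNorm (h.choose z) (deriv h.choose z) else 0

theorem orthPart_self {N : ℕ} (x : HomCoord N) : orthPart x x = 0 := by
  unfold orthPart
  rcases eq_or_ne x 0 with rfl | hx
  · simp
  · have h : ((‖x‖ : ℝ) : ℂ) ≠ 0 := by simpa using hx
    rw [inner_self_eq_norm_sq_to_K]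
    erw [div_self (pow_ne_zero 2 h)]
    simp

theorem orthPart_add {N : ℕ} (x v w : HomCoord N) :
    orthPart x (v + w) = orthPart x v + orthPart x w := by
  unfold orthPart
  rw [inner_add_right, add_div, add_smul]
  abel

theorem orthPart_smul {N : ℕ} (x v : HomCoord N) (c : ℂ) :
    orthPart x (c • v) = c • orthPart x v := by
  unfold orthPart
  rw [inner_smul_right, smul_sub, smul_smul, mul_div_assoc]

theorem orthPart_smul_left {N : ℕ} (x v : HomCoord N) (c : ℂ) (hc : c ≠ 0) :
    orthPart (c • x) v = orthPart x v := by
  unfold orthPart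
  rcases eq_or_ne x 0 with rfl | hx
  · simp
  have h : ((‖x‖ : ℝ) : ℂ) ≠ 0 := by simpa using hx
  have h2 : (starRingEnd ℂ) c ≠ 0 := by simpa using hc
  rw [inner_smul_left, norm_smul, smul_smul]
  congr 2
  push_cast
  rw [mul_pow, ← Complex.mul_conj']
  field_simp

/-- The Fubini–Study length is that of a tangent vector of `ℂP^N`: replacing a lift `F` by `c F`
does not change it. -/
theorem fsNorm_change {N : ℕ} (x v : HomCoord N) (c d : ℂ) (hc : c ≠ 0) :
    fsNorm (c • x) (c • v + d • x) = fsNorm x v := by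
  unfold fsNorm
  have hc' : ‖c‖ ≠ 0 := norm_ne_zero_iff.2 hc
  rw [orthPart_smul_left _ _ _ hc, orthPart_add, orthPart_smul, orthPart_smul, orthPart_self,
    smul_zero, add_zero, norm_smul, norm_smul,
    show Real.sqrt Real.pi * (‖c‖ * ‖x‖) = ‖c‖ * (Real.sqrt Real.pi * ‖x‖) by ring,
    mul_div_mul_left _ _ hc']

theorem IsLiftAt.fsNorm_eq {N : ℕ} {f : ℂ → CP N} {z : ℂ} {F G : ℂ → HomCoord N}
    (hF : IsLiftAt f z F) (hG : IsLiftAt f z G) :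
    fsNorm (G z) (deriv G z) = fsNorm (F z) (deriv F z) := by
  have hFz : F z ≠ 0 := hF.2.self_of_nhds.1
  let ℓ : HomCoord N →L[ℂ] ℂ := innerSL ℂ (F z)
  have hℓF : AnalyticAt ℂ (fun w => ℓ (F w)) z := (ℓ.analyticAt _).comp hF.1
  have hℓG : AnalyticAt ℂ (fun w => ℓ (G w)) z := (ℓ.analyticAt _).comp hG.1
  have hℓz : ℓ (F z) ≠ 0 := by
    change inner ℂ (F z) (F z) ≠ 0
    exact inner_self_ne_zero.2 hFz
  have hne : ∀ᶠ w in 𝓝 z, ℓ (F w) ≠ 0 := hℓF.continuousAt.eventually_ne hℓz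
  let c : ℂ → ℂ := fun w => ℓ (G w) / ℓ (F w)
  have hc : AnalyticAt ℂ c z := hℓG.div hℓF hℓz
  have hmain : ∀ᶠ w in 𝓝 z, G w = c w • F w ∧ c w ≠ 0 := by
    filter_upwards [hF.2, hG.2, hne] with w hw1 hw2 hw3
    obtain ⟨h1, e1⟩ := hw1
    obtain ⟨h2, e2⟩ := hw2
    obtain ⟨a, ha⟩ := (Projectivization.mk_eq_mk_iff' ℂ _ _ h2 h1).1 (e2.symm.trans e1)
    have hca : c w = a := by
      change ℓ (G w) / ℓ (F w) = a
      rw [← ha, map_smul, smul_eq_mul, mul_div_assoc, div_self hw3, mul_one]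
    refine ⟨by rw [hca, ha], ?_⟩
    rw [hca]
    rintro rfl
    exact h2 (by rw [← ha, zero_smul])
  have hev : G =ᶠ[𝓝 z] fun w => c w • F w := hmain.mono fun w hw => hw.1
  have hd : deriv G z = c z • deriv F z + deriv c z • F z := by
    rw [hev.deriv_eq]
    exact deriv_fun_smul hc.differentiableAt hF.1.differentiableAt
  rw [hd, hmain.self_of_nhds.1]
  exact fsNorm_change _ _ _ _ hmain.self_of_nhds.2

theorem speed_eq {N : ℕ} {f : ℂ → CP N} {z : ℂ} {F : ℂ → HomCoord N} (hF : IsLiftAt f z F) :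
    speed f z = fsNorm (F z) (deriv F z) := by
  have h : ∃ F : ℂ → HomCoord N, IsLiftAt f z F := ⟨F, hF⟩
  unfold speed
  rw [dif_pos h]
  exact hF.fsNorm_eq h.choose_spec

theorem norm_orthPart_sq {N : ℕ} (x v : HomCoord N) (hx : x ≠ 0) :
    ‖orthPart x v‖ ^ 2 = ‖v‖ ^ 2 - ‖(inner ℂ x v : ℂ)‖ ^ 2 / ‖x‖ ^ 2 := by
  have h : ‖x‖ ≠ 0 := norm_ne_zero_iff.2 hx
  unfold orthPart
  rw [@norm_sub_sq ℂ, inner_smul_right, norm_smul]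
  have e : inner ℂ x v / (‖x‖ : ℂ) ^ 2 * inner ℂ v x
      = (((‖(inner ℂ x v : ℂ)‖ ^ 2 / ‖x‖ ^ 2 : ℝ)) : ℂ) := by
    rw [div_mul_eq_mul_div, ← inner_conj_symm v x, Complex.mul_conj']
    push_cast; rfl
  rw [e, norm_div, norm_pow, Complex.norm_real, norm_norm]
  change ‖v‖ ^ 2 - 2 * (((‖(inner ℂ x v : ℂ)‖ ^ 2 / ‖x‖ ^ 2 : ℝ) : ℂ)).re + _ = _
  rw [Complex.ofReal_re]
  field_simp
  ring

theorem fsDistCoord_eq_arcsin {N : ℕ} (x y : HomCoord N) (hx : x ≠ 0) (hy : y ≠ 0) :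
    fsDistCoord x y = Real.arcsin (‖orthPart x y‖ / ‖y‖) / Real.sqrt Real.pi := by
  have h : ‖x‖ ≠ 0 := norm_ne_zero_iff.2 hx
  have h' : ‖y‖ ≠ 0 := norm_ne_zero_iff.2 hy
  unfold fsDistCoord
  rw [Real.arccos_eq_arcsin (by positivity)]
  congr 2
  rw [← Real.sqrt_sq (by positivity : 0 ≤ ‖orthPart x y‖ / ‖y‖), div_pow ‖orthPart x y‖, norm_orthPart_sq x y hx]
  congr 1
  field_simp
/-- `speed f z` is the local Lipschitz constant of `f` at `z` for the distance `dFS`. -/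
theorem tendsto_speed {N : ℕ} {f : ℂ → CP N} (hf : IsHolomorphicCurve f) (z : ℂ) :
    Tendsto (fun w => dFS (f z) (f w) / ‖w - z‖) (𝓝[≠] z) (𝓝 (speed f z)) := by
  obtain ⟨F, hF⟩ := hf z
  rw [speed_eq hF]
  obtain ⟨hz, ez⟩ := hF.2.self_of_nhds
  have hFd := hF.1.differentiableAt.hasDerivAt
  have hsl : Tendsto (fun w => ‖orthPart (F z) (F w)‖ / ‖w - z‖) (𝓝[≠] z)
      (𝓝 ‖orthPart (F z) (deriv F z)‖) := by
    have hc : Continuous (orthPart (F z)) := by unfold orthPart; fun_prop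
    have := ((hc.tendsto _).comp (hasDerivAt_iff_tendsto_slope.1 hFd)).norm
    refine this.congr fun w => ?_
    have h0 : orthPart (F z) (F w - F z) = orthPart (F z) (F w) := by
      rw [sub_eq_add_neg, orthPart_add, ← neg_one_smul ℂ (F z), orthPart_smul, orthPart_self]; simp
    simp only [Function.comp, slope_def_module, orthPart_smul, h0, norm_smul, norm_inv]
    rw [div_eq_inv_mul]
  have hnF : Tendsto (fun w => ‖F w‖) (𝓝[≠] z) (𝓝 ‖F z‖) :=
    (hF.1.continuousAt.norm.tendsto).mono_left nhdsWithin_le_nhds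
  have hnz : ‖F z‖ ≠ 0 := norm_ne_zero_iff.2 hz
  have ht : Tendsto (fun w => ‖orthPart (F z) (F w)‖ / ‖F w‖) (𝓝[≠] z) (𝓝 0) := by
    have hc : Continuous (orthPart (F z)) := by unfold orthPart; fun_prop
    have h1 := ((hc.continuousAt.comp hF.1.continuousAt).norm.tendsto).mono_left
      (nhdsWithin_le_nhds (s := {z}ᶜ))
    have := h1.div hnF hnz
    have h2 : ‖orthPart (F z) (F z)‖ / ‖F z‖ = 0 := by simp [orthPart_self]
    exact h2 ▸ this
  have has : Tendsto (dslope Real.arcsin 0) (𝓝 0) (𝓝 1) := by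
    have hd : HasDerivAt Real.arcsin 1 0 := by
      simpa using Real.hasDerivAt_arcsin (x := 0) (by norm_num) (by norm_num)
    have := (continuousAt_dslope_same.2 hd.differentiableAt).tendsto
    rwa [dslope_same, hd.deriv] at this
  have hfin := ((has.comp ht).mul (hsl.div hnF hnz)).div_const (Real.sqrt Real.pi)
  have e : 1 * (‖orthPart (F z) (deriv F z)‖ / ‖F z‖) / Real.sqrt Real.pi
      = fsNorm (F z) (deriv F z) := by unfold fsNorm; rw [one_mul, div_div, mul_comm]
  rw [e] at hfin
  refine hfin.congr' ?_
  filter_upwards [nhdsWithin_le_nhds hF.2] with w hw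
  obtain ⟨hw, ew⟩ := hw
  rw [ez, ew, dFS_mk, fsDistCoord_eq_arcsin _ _ hz hw]
  have key : ∀ t : ℝ, Real.arcsin t = dslope Real.arcsin 0 t * t := by
    intro t
    have := sub_smul_dslope Real.arcsin 0 t
    simp at this
    rw [← this, mul_comm]
  rw [key]
  simp only [Function.comp, Pi.div_apply]
  field_simp

/-- `f` is `R`-nondegenerate: every closed disk of radius `R` contains a point
where `|df| ≥ 1/R`. -/
def IsNondegenerate {N : ℕ} (R : ℝ) (f : ℂ → CP N) : Prop :=
  ∀ a : ℂ, ∃ z : ℂ, ‖z - a‖ ≤ R ∧ 1 / R ≤ speed f z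

/-- The space of holomorphic curves `f : ℂ → ℂP^N` with `|df| ≤ r` everywhere. -/
def LipCurves (N : ℕ) (r : ℝ) : Set (ℂ → CP N) :=
  {f | IsHolomorphicCurve f ∧ ∀ z : ℂ, speed f z ≤ r}

/-- The space of Brody curves in `ℂP^N`. -/
abbrev BrodyCurves (N : ℕ) : Set (ℂ → CP N) := LipCurves N 1

/-- The uniform distance `sup_z d_FS(f(z), g(z))` over the whole plane. -/
def dC {N : ℕ} (f g : ℂ → CP N) : ℝ := ⨆ z : ℂ, dFS (f z) (g z)

/-- The closed ball, in the space of Brody curves, for the uniform distance. -/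
def brodyBall {N : ℕ} (r : ℝ) (f : ℂ → CP N) : Set (ℂ → CP N) :=
  {g | g ∈ BrodyCurves N ∧ dC f g ≤ r}

theorem mem_brodyBall_self {N : ℕ} {r : ℝ} (hr : 0 < r) {f : ℂ → CP N}
    (hf : f ∈ BrodyCurves N) : f ∈ brodyBall r f := by
  refine ⟨hf, ?_⟩
  unfold dC
  simp only [dFS_self, ciSup_const]
  exact hr.le

/-- The square of side length `L` with corner `a` and with sides in the directions of the unit
complex numbers `u` and `u i`. -/
def square (a u : ℂ) (L : ℝ) : Set ℂ :=
  {z | ∃ x ∈ Set.Icc (0 : ℝ) L, ∃ y ∈ Set.Icc (0 : ℝ) L, z = a + u * (x + y * Complex.I)}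

end Brody

end

/-!
A Brody curve is degenerate near `a` when `|df| < 1 / (20 R)` on the disk of radius `R` about `a`.
Choose a maximal `R`-separated set `Λ` of such centres, a unit vector `v_a` over `f a` and a unit
vector `u_a` orthogonal to it, and deform every curve `g` close to `f` to `A · g`, where
`A w = 1 + ∑ a ∈ Λ, 8000 (w - a)⁻³ u_a ⟨v_a, ·⟩`. Triple poles make the sum over an `R`-separated
set converge, with a tail of size `O(R⁻³)`, so `A` is close to the identity away from `Λ`. Near a
pole `a`, the lift `F` of `g` with `⟨v_a, F⟩ = 1` is close to the constant `v_a`, and `(w - a)³ A F`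
is close to `(w - a)³ v_a + 8000 u_a`. With `r = |w - a|` the speed of this model is of
order `12 r² / (r³ + 20³)`, which stays below `1`, while the model moves by a definite chordal
distance between `r = 0` and `r = 40`; hence the deformed curve has speed at least `1 / (25 R)`
somewhere near every point.

The deformation is bi-Lipschitz pointwise at distance at least `1` from the poles, and the lower
bound propagates into the unit disks around the poles by the maximum principle. For the energy, the
speeds of `f` and of its deformation nearly agree off the disks of radius `√R` around the poles, and
these occupy a proportion `O(1 / R)` of every large square.
-/

namespace Brody

variable {N : ℕ}

/-! ### The chordal distance on projective space -/

theorem orthPart_eq_starProjection (x v : HomCoord N) :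
    orthPart x v = (ℂ ∙ x)ᗮ.starProjection v := by
  rw [Submodule.starProjection_orthogonal_val, Submodule.starProjection_singleton]
  simp only [orthPart, Complex.coe_algebraMap, Complex.ofReal_pow]

theorem norm_orthPart_le_norm (x v : HomCoord N) : ‖orthPart x v‖ ≤ ‖v‖ := by
  rw [orthPart_eq_starProjection]
  exact Submodule.norm_starProjection_apply_le _ v

theorem continuous_orthPart (x : HomCoord N) : Continuous (orthPart x) := by
  unfold orthPart
  fun_prop

theorem orthPart_sub_smul (x v : HomCoord N) (c : ℂ) : orthPart x (v - c • x) = orthPart x v := by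
  rw [sub_eq_add_neg, ← neg_smul, orthPart_add, orthPart_smul, orthPart_self, smul_zero, add_zero]

theorem norm_orthPart_le_norm_sub_smul (x v : HomCoord N) (c : ℂ) :
    ‖orthPart x v‖ ≤ ‖v - c • x‖ :=
  orthPart_sub_smul x v c ▸ norm_orthPart_le_norm x _

theorem exists_orthPart_eq_sub_smul (x v : HomCoord N) :
    ∃ c : ℂ, orthPart x v = v - c • x ∧ ‖c • x‖ ≤ ‖v‖ := by
  refine ⟨_, rfl, ?_⟩
  have h := Submodule.norm_starProjection_apply_le (ℂ ∙ x) v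
  rwa [Submodule.starProjection_singleton, RCLike.ofReal_pow] at h

/-- The sine of the angle between the complex lines through `x` and `y`: the chordal distance of
`[x]` and `[y]`, in homogeneous coordinates. Unlike `fsDistCoord` it is controlled by
elementary estimates. -/
noncomputable def chordalDistCoord (x y : HomCoord N) : ℝ := ‖orthPart x y‖ / ‖y‖

theorem chordalDistCoord_nonneg (x y : HomCoord N) : 0 ≤ chordalDistCoord x y := by
  unfold chordalDistCoord
  positivity

theorem chordalDistCoord_mul_norm (x : HomCoord N) {y : HomCoord N} (hy : y ≠ 0) :
    chordalDistCoord x y * ‖y‖ = ‖orthPart x y‖ :=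
  div_mul_cancel₀ _ (norm_ne_zero_iff.2 hy)

theorem chordalDistCoord_le_one (x y : HomCoord N) : chordalDistCoord x y ≤ 1 :=
  div_le_one_of_le₀ (norm_orthPart_le_norm _ _) (norm_nonneg _)

theorem chordalDistCoord_le_norm_sub_smul_div (x y : HomCoord N) (c : ℂ) :
    chordalDistCoord x y ≤ ‖y - c • x‖ / ‖y‖ :=
  div_le_div_of_nonneg_right (norm_orthPart_le_norm_sub_smul x y c) (norm_nonneg _)

theorem chordalDistCoord_smul (x y : HomCoord N) {a b : ℂ} (ha : a ≠ 0) (hb : b ≠ 0) :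
    chordalDistCoord (a • x) (b • y) = chordalDistCoord x y := by
  unfold chordalDistCoord
  rw [orthPart_smul_left _ _ _ ha, orthPart_smul, norm_smul, norm_smul,
    mul_div_mul_left _ _ (norm_ne_zero_iff.2 hb)]

theorem chordalDistCoord_triangle (x : HomCoord N) {y z : HomCoord N} (hy : y ≠ 0) (hz : z ≠ 0) :
    chordalDistCoord x z ≤ chordalDistCoord x y + chordalDistCoord y z := by
  obtain ⟨c, hc, hcz⟩ := exists_orthPart_eq_sub_smul y z
  obtain ⟨d, hd, -⟩ := exists_orthPart_eq_sub_smul x y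
  have hsplit : z - (c * d) • x = orthPart y z + c • orthPart x y := by
    rw [hc, hd, smul_sub, smul_smul, sub_add_sub_cancel]
  refine (chordalDistCoord_le_norm_sub_smul_div x z (c * d)).trans ?_
  rw [div_le_iff₀ (norm_pos_iff.2 hz), hsplit]
  calc ‖orthPart y z + c • orthPart x y‖
      ≤ ‖orthPart y z‖ + ‖c • orthPart x y‖ := norm_add_le _ _
    _ = chordalDistCoord y z * ‖z‖ + chordalDistCoord x y * ‖c • y‖ := by
        rw [norm_smul, norm_smul, chordalDistCoord_mul_norm y hz, ← chordalDistCoord_mul_norm x hy]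
        ring
    _ ≤ chordalDistCoord y z * ‖z‖ + chordalDistCoord x y * ‖z‖ := by
        gcongr
        exact chordalDistCoord_nonneg x y
    _ = _ := by ring

theorem fsDistCoord_eq_arcsin_chordalDistCoord {x y : HomCoord N} (hx : x ≠ 0) (hy : y ≠ 0) :
    fsDistCoord x y = Real.arcsin (chordalDistCoord x y) / √Real.pi :=
  fsDistCoord_eq_arcsin x y hx hy

theorem sqrt_pi_lt_two : √Real.pi < 2 := by
  rw [Real.sqrt_lt' (by norm_num)]
  linarith [Real.pi_lt_four]

theorem one_lt_sqrt_pi : 1 < √Real.pi := by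
  rw [Real.lt_sqrt (by norm_num)]
  linarith [Real.pi_gt_three]

theorem le_arcsin {t : ℝ} (h₀ : 0 ≤ t) (h₁ : t ≤ 1) : t ≤ Real.arcsin t := by
  conv_lhs => rw [← Real.sin_arcsin (by linarith) h₁]
  exact Real.sin_le (Real.arcsin_nonneg.2 h₀)

theorem arcsin_le_pi_div_two_mul {t : ℝ} (h₀ : 0 ≤ t) (h₁ : t ≤ 1) :
    Real.arcsin t ≤ Real.pi / 2 * t := by
  have h := Real.mul_le_sin (Real.arcsin_nonneg.2 h₀) (Real.arcsin_le_pi_div_two t)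
  rw [Real.sin_arcsin (by linarith) h₁] at h
  calc Real.arcsin t = Real.pi / 2 * (2 / Real.pi * Real.arcsin t) := by field_simp
    _ ≤ _ := by gcongr

theorem chordalDistCoord_le_two_mul_fsDistCoord {x y : HomCoord N} (hx : x ≠ 0) (hy : y ≠ 0) :
    chordalDistCoord x y ≤ 2 * fsDistCoord x y := by
  rw [fsDistCoord_eq_arcsin_chordalDistCoord hx hy, mul_div_assoc',
    le_div_iff₀ (by linarith [one_lt_sqrt_pi])]
  have h := le_arcsin (chordalDistCoord_nonneg x y) (chordalDistCoord_le_one x y)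
  nlinarith [sqrt_pi_lt_two, chordalDistCoord_nonneg x y]

theorem fsDistCoord_le_chordalDistCoord {x y : HomCoord N} (hx : x ≠ 0) (hy : y ≠ 0) :
    fsDistCoord x y ≤ chordalDistCoord x y := by
  have h₀ := chordalDistCoord_nonneg x y
  rw [fsDistCoord_eq_arcsin_chordalDistCoord hx hy, div_le_iff₀ (by linarith [one_lt_sqrt_pi])]
  have hpi : Real.pi / 2 ≤ √Real.pi := by
    nlinarith [Real.sq_sqrt Real.pi_pos.le, one_lt_sqrt_pi, sqrt_pi_lt_two]
  calc Real.arcsin (chordalDistCoord x y) ≤ Real.pi / 2 * chordalDistCoord x y :=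
        arcsin_le_pi_div_two_mul h₀ (chordalDistCoord_le_one x y)
    _ ≤ √Real.pi * chordalDistCoord x y := by gcongr
    _ = _ := mul_comm _ _

/-- The chordal distance on `ℂP^N`, equivalent to `dFS` and at most one. -/
noncomputable def chordalDist (p q : CP N) : ℝ := chordalDistCoord p.rep q.rep

theorem chordalDist_mk {x y : HomCoord N} (hx : x ≠ 0) (hy : y ≠ 0) :
    chordalDist (.mk ℂ x hx) (.mk ℂ y hy) = chordalDistCoord x y := by
  obtain ⟨a, ha⟩ := Projectivization.exists_smul_eq_mk_rep ℂ x hx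
  obtain ⟨b, hb⟩ := Projectivization.exists_smul_eq_mk_rep ℂ y hy
  unfold chordalDist
  rw [← ha, ← hb]
  exact chordalDistCoord_smul x y a.ne_zero b.ne_zero

theorem chordalDist_nonneg (p q : CP N) : 0 ≤ chordalDist p q := chordalDistCoord_nonneg _ _

theorem chordalDist_self (p : CP N) : chordalDist p p = 0 := by
  simp [chordalDist, chordalDistCoord, orthPart_self]

theorem chordalDist_triangle (p q r : CP N) :
    chordalDist p r ≤ chordalDist p q + chordalDist q r :=
  chordalDistCoord_triangle _ q.rep_nonzero r.rep_nonzero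

theorem chordalDist_le_two_mul_dFS (p q : CP N) : chordalDist p q ≤ 2 * dFS p q :=
  chordalDistCoord_le_two_mul_fsDistCoord p.rep_nonzero q.rep_nonzero

theorem dFS_le_chordalDist (p q : CP N) : dFS p q ≤ chordalDist p q :=
  fsDistCoord_le_chordalDistCoord p.rep_nonzero q.rep_nonzero

theorem dFS_nonneg (p q : CP N) : 0 ≤ dFS p q :=
  div_nonneg (Real.arccos_nonneg _) (Real.sqrt_nonneg _)

theorem dFS_le_one (p q : CP N) : dFS p q ≤ 1 :=
  (dFS_le_chordalDist p q).trans (chordalDistCoord_le_one _ _)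

theorem bddAbove_range_dFS {ι : Sort*} (p q : ι → CP N) :
    BddAbove (Set.range fun i => dFS (p i) (q i)) :=
  ⟨1, Set.forall_mem_range.2 fun _ => dFS_le_one _ _⟩

theorem dFS_le_dC (f g : ℂ → CP N) (z : ℂ) : dFS (f z) (g z) ≤ dC f g :=
  le_ciSup (bddAbove_range_dFS f g) z

/-! ### The effect of linear maps -/

section LinearMap

variable (M : HomCoord N →L[ℂ] HomCoord N) {m K : ℝ}

theorem norm_orthPart_map_le (x v : HomCoord N) :
    ‖orthPart (M x) (M v)‖ ≤ ‖M‖ * ‖orthPart x v‖ := by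
  obtain ⟨c, hc, -⟩ := exists_orthPart_eq_sub_smul x v
  refine (norm_orthPart_le_norm_sub_smul _ _ c).trans ?_
  rw [← map_smul, ← map_sub, ← hc]
  exact M.le_opNorm _

theorem mul_norm_orthPart_le_map (hm : 0 ≤ m) (hM : ∀ w, m * ‖w‖ ≤ ‖M w‖) (x v : HomCoord N) :
    m * ‖orthPart x v‖ ≤ ‖orthPart (M x) (M v)‖ := by
  obtain ⟨c, hc, -⟩ := exists_orthPart_eq_sub_smul (M x) (M v)
  rw [hc, ← map_smul, ← map_sub]
  exact (mul_le_mul_of_nonneg_left (norm_orthPart_le_norm_sub_smul x v c) hm).trans (hM _)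

theorem chordalDistCoord_map_le (hm : 0 < m) (hK : ‖M‖ ≤ K) (x : HomCoord N) {y : HomCoord N}
    (hy : y ≠ 0) (hMy : m * ‖y‖ ≤ ‖M y‖) :
    chordalDistCoord (M x) (M y) ≤ K / m * chordalDistCoord x y := by
  have : 0 < ‖y‖ := norm_pos_iff.2 hy
  have : 0 ≤ K := (norm_nonneg _).trans hK
  calc ‖orthPart (M x) (M y)‖ / ‖M y‖ ≤ K * ‖orthPart x y‖ / (m * ‖y‖) := by
        gcongr
        exact (norm_orthPart_map_le M x y).trans (by gcongr)
    _ = _ := mul_div_mul_comm _ _ _ _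

theorem chordalDistCoord_le_map (hm : 0 < m) (hM : ∀ w, m * ‖w‖ ≤ ‖M w‖) (hK : ‖M‖ ≤ K)
    (x : HomCoord N) {y : HomCoord N} (hy : y ≠ 0) :
    chordalDistCoord x y ≤ K / m * chordalDistCoord (M x) (M y) := by
  have hy₀ : 0 < ‖y‖ := norm_pos_iff.2 hy
  have hMy₀ : 0 < ‖M y‖ := (mul_pos hm hy₀).trans_le (hM y)
  have : 0 ≤ K := (norm_nonneg _).trans hK
  unfold chordalDistCoord
  rw [div_mul_div_comm, div_le_div_iff₀ hy₀ (by positivity)]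
  calc ‖orthPart x y‖ * (m * ‖M y‖) = m * ‖orthPart x y‖ * ‖M y‖ := by ring
    _ ≤ ‖orthPart (M x) (M y)‖ * (K * ‖y‖) := by
        gcongr
        exacts [mul_norm_orthPart_le_map M hm.le hM x y, M.le_of_opNorm_le hK y]
    _ = _ := by ring

theorem fsNorm_nonneg (x v : HomCoord N) : 0 ≤ fsNorm x v := by
  unfold fsNorm
  positivity

theorem fsNorm_le_norm_div (x v : HomCoord N) : fsNorm x v ≤ ‖v‖ / ‖x‖ := by
  rcases eq_or_ne x 0 with rfl | hx
  · simp [fsNorm]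
  have hx₀ : 0 < ‖x‖ := norm_pos_iff.2 hx
  exact div_le_div₀ (norm_nonneg _) (norm_orthPart_le_norm x v) hx₀
    (le_mul_of_one_le_left hx₀.le one_lt_sqrt_pi.le)

theorem fsNorm_add_le (x v w : HomCoord N) : fsNorm x (v + w) ≤ fsNorm x v + fsNorm x w := by
  unfold fsNorm
  rw [orthPart_add, ← add_div]
  gcongr
  exact norm_add_le _ _

theorem abs_fsNorm_add_sub_le (x v w : HomCoord N) :
    |fsNorm x (v + w) - fsNorm x v| ≤ fsNorm x w := by
  have hneg : fsNorm x (-w) = fsNorm x w := by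
    rw [fsNorm, ← neg_one_smul ℂ, orthPart_smul, neg_one_smul, norm_neg, fsNorm]
  have hsub := fsNorm_add_le x (v + w) (-w)
  rw [add_neg_cancel_right, hneg] at hsub
  exact abs_le.2 ⟨by linarith, by linarith [fsNorm_add_le x v w]⟩

theorem fsNorm_map_le (hm : 0 < m) (hK : ‖M‖ ≤ K) {x : HomCoord N} (hx : x ≠ 0)
    (hMx : m * ‖x‖ ≤ ‖M x‖) (v : HomCoord N) : fsNorm (M x) (M v) ≤ K / m * fsNorm x v := by
  have : 0 < ‖x‖ := norm_pos_iff.2 hx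
  have : 0 ≤ K := (norm_nonneg _).trans hK
  have := one_lt_sqrt_pi
  calc ‖orthPart (M x) (M v)‖ / (√Real.pi * ‖M x‖)
      ≤ K * ‖orthPart x v‖ / (√Real.pi * (m * ‖x‖)) := by
        gcongr
        exact (norm_orthPart_map_le M x v).trans (by gcongr)
    _ = _ := by rw [mul_left_comm, mul_div_mul_comm]; rfl

theorem div_mul_fsNorm_le_map (hm : 0 < m) (hM : ∀ w, m * ‖w‖ ≤ ‖M w‖) (hK : ‖M‖ ≤ K)
    {x : HomCoord N} (hx : x ≠ 0) (v : HomCoord N) :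
    m / K * fsNorm x v ≤ fsNorm (M x) (M v) := by
  have hx₀ : 0 < ‖x‖ := norm_pos_iff.2 hx
  have hMx₀ : 0 < ‖M x‖ := (mul_pos hm hx₀).trans_le (hM x)
  have := one_lt_sqrt_pi
  calc m / K * (‖orthPart x v‖ / (√Real.pi * ‖x‖))
      = m * ‖orthPart x v‖ / (√Real.pi * (K * ‖x‖)) := by
        rw [← mul_div_mul_comm, mul_left_comm K]
    _ ≤ ‖orthPart (M x) (M v)‖ / (√Real.pi * ‖M x‖) := by
        gcongr
        exacts [mul_norm_orthPart_le_map M hm.le hM x v, M.le_of_opNorm_le hK x]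

end LinearMap

/-! ### Speed and displacement -/

theorem IsLiftAt.eventually {f : ℂ → CP N} {z : ℂ} {F : ℂ → HomCoord N} (h : IsLiftAt f z F) :
    ∀ᶠ w in 𝓝 z, IsLiftAt f w F :=
  h.1.eventually_analyticAt.and (eventually_eventually_nhds.2 h.2)

theorem IsLiftAt.ne_zero {f : ℂ → CP N} {z : ℂ} {F : ℂ → HomCoord N} (h : IsLiftAt f z F) :
    F z ≠ 0 :=
  h.2.self_of_nhds.1

theorem speed_nonneg (f : ℂ → CP N) (z : ℂ) : 0 ≤ speed f z := by
  unfold speed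
  split_ifs
  exacts [fsNorm_nonneg _ _, le_rfl]

theorem continuousAt_fsNorm {X : Type*} [TopologicalSpace X] {F G : X → HomCoord N} {z : X}
    (hF : ContinuousAt F z) (hG : ContinuousAt G z) (hz : F z ≠ 0) :
    ContinuousAt (fun w => fsNorm (F w) (G w)) z := by
  have hFz : ‖F z‖ ≠ 0 := norm_ne_zero_iff.2 hz
  have hsq : ContinuousAt (fun w => (‖F w‖ : ℂ) ^ 2) z :=
    (Complex.continuous_ofReal.continuousAt.comp hF.norm).pow 2
  have hsq₀ : (‖F z‖ : ℂ) ^ 2 ≠ 0 := pow_ne_zero 2 (Complex.ofReal_ne_zero.2 hFz)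
  exact (hG.sub (((hF.inner (𝕜 := ℂ) hG).div hsq hsq₀).smul hF)).norm.div
    (continuousAt_const.mul hF.norm) (mul_ne_zero (by linarith [one_lt_sqrt_pi]) hFz)

theorem continuous_speed {f : ℂ → CP N} (hf : IsHolomorphicCurve f) : Continuous (speed f) := by
  refine continuous_iff_continuousAt.2 fun z => ?_
  obtain ⟨F, hF⟩ := hf z
  refine (continuousAt_fsNorm hF.1.continuousAt hF.1.deriv.continuousAt hF.ne_zero).congr ?_
  filter_upwards [hF.eventually] with w hw using (speed_eq hw).symm

theorem continuous_chordalDist {f : ℂ → CP N} (hf : IsHolomorphicCurve f) (p : CP N) :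
    Continuous fun z => chordalDist p (f z) := by
  refine continuous_iff_continuousAt.2 fun z => ?_
  obtain ⟨F, hF⟩ := hf z
  have h : ContinuousAt (fun w => chordalDistCoord p.rep (F w)) z :=
    ((continuous_orthPart p.rep).continuousAt.comp hF.1.continuousAt).norm.div
      hF.1.continuousAt.norm (norm_ne_zero_iff.2 hF.ne_zero)
  refine h.congr ?_
  filter_upwards [hF.2] with w ⟨hw, hfw⟩
  rw [hfw, ← chordalDist_mk p.rep_nonzero hw, p.mk_rep]

theorem eventually_chordalDist_lt {f : ℂ → CP N} (hf : IsHolomorphicCurve f) {z : ℂ} {c : ℝ}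
    (hc : speed f z < c) : ∀ᶠ w in 𝓝[≠] z, chordalDist (f z) (f w) < 2 * c * ‖w - z‖ := by
  filter_upwards [(tendsto_speed hf z).eventually_lt_const hc, self_mem_nhdsWithin] with w hw hwz
  rw [div_lt_iff₀ (norm_pos_iff.2 (sub_ne_zero.2 hwz))] at hw
  linarith [chordalDist_le_two_mul_dFS (f z) (f w)]

theorem chordalDist_le_of_speed_le {f : ℂ → CP N} (hf : IsHolomorphicCurve f) {a z : ℂ} {c : ℝ}
    (hc : ∀ w, ‖w - a‖ ≤ ‖z - a‖ → speed f w ≤ c) :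
    chordalDist (f a) (f z) ≤ 2 * c * ‖z - a‖ := by
  rcases eq_or_ne z a with rfl | hza
  · simp [chordalDist_self]
  have hd : 0 < ‖z - a‖ := norm_pos_iff.2 (sub_ne_zero.2 hza)
  set γ : ℝ → ℂ := fun t => a + t * (z - a) with hγ
  have hγ_cont : Continuous γ := by fun_prop
  have hγ_sub (s t : ℝ) : γ t - γ s = ((t - s : ℝ) : ℂ) * (z - a) := by
    simp only [hγ, Complex.ofReal_sub]
    ring
  have hγ_tendsto (t : ℝ) : Tendsto γ (𝓝[>] t) (𝓝[≠] (γ t)) := by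
    refine hγ_cont.continuousWithinAt.tendsto_nhdsWithin fun s hs => sub_ne_zero.1 ?_
    rw [hγ_sub]
    exact mul_ne_zero (Complex.ofReal_ne_zero.2 (sub_pos.2 hs).ne') (sub_ne_zero.2 hza)
  have hγ_speed : ∀ t ∈ Set.Ico (0 : ℝ) 1, speed f (γ t) ≤ c := fun t ht => hc _ <| by
    rw [hγ, add_sub_cancel_left, norm_mul, Complex.norm_of_nonneg ht.1]
    exact mul_le_of_le_one_left hd.le ht.2.le
  have hslope : ∀ t ∈ Set.Ico (0 : ℝ) 1, ∀ r, 2 * c * ‖z - a‖ < r →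
      ∃ᶠ s in 𝓝[>] t, slope (fun t => chordalDist (f a) (f (γ t))) t s < r := fun t ht r hr => by
    have hlt : speed f (γ t) < r / (2 * ‖z - a‖) :=
      (hγ_speed t ht).trans_lt ((lt_div_iff₀ (by positivity)).2 (by linarith))
    refine Eventually.frequently ?_
    filter_upwards [(hγ_tendsto t).eventually (eventually_chordalDist_lt hf hlt),
      self_mem_nhdsWithin] with s hs hts
    have hst : 0 < s - t := sub_pos.2 hts
    rw [hγ_sub, norm_mul, Complex.norm_of_nonneg hst.le] at hs
    rw [slope_def_field, div_lt_iff₀ hst, sub_lt_iff_lt_add']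
    refine (chordalDist_triangle _ (f (γ t)) _).trans_lt ?_
    gcongr
    exact hs.trans_eq (by field_simp)
  simpa [hγ] using image_le_of_liminf_slope_right_le_deriv_boundary
    (f := fun t => chordalDist (f a) (f (γ t))) (b := 1) (B := fun t => 2 * c * ‖z - a‖ * t)
    ((continuous_chordalDist hf (f a)).comp hγ_cont).continuousOn
    (by simp [hγ, chordalDist_self]) (by fun_prop)
    (fun t _ => ((hasDerivAt_id t).const_mul _).hasDerivWithinAt.congr_deriv (mul_one _))
    hslope (x := 1) (by simp)

/-! ### Affine charts -/

/-- The representative of `p` whose component along `v` is one: the affine chart of `ℂP^N` given by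
`v`. It is meaningful only off the hyperplane `v⊥`, where it takes the value `0`. -/
noncomputable def affineRep (v : HomCoord N) (p : CP N) : HomCoord N :=
  (inner ℂ v p.rep)⁻¹ • p.rep

section AffineRep

variable {v : HomCoord N} {p q : CP N}

theorem affineRep_mk (v : HomCoord N) {y : HomCoord N} (hy : y ≠ 0) :
    affineRep v (.mk ℂ y hy) = (inner ℂ v y)⁻¹ • y := by
  obtain ⟨a, ha⟩ := Projectivization.exists_smul_eq_mk_rep ℂ y hy
  rw [affineRep, ← ha, Units.smul_def, inner_smul_right, smul_smul, mul_inv, mul_right_comm,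
    inv_mul_cancel₀ a.ne_zero, one_mul]

theorem inner_affineRep (hp : inner ℂ v p.rep ≠ 0) : inner ℂ v (affineRep v p) = 1 := by
  rw [affineRep, inner_smul_right, inv_mul_cancel₀ hp]

theorem affineRep_ne_zero (hp : inner ℂ v p.rep ≠ 0) : affineRep v p ≠ 0 :=
  smul_ne_zero (inv_ne_zero hp) p.rep_nonzero

theorem mk_affineRep (hp : inner ℂ v p.rep ≠ 0) :
    .mk ℂ (affineRep v p) (affineRep_ne_zero hp) = p := by
  conv_rhs => rw [← p.mk_rep]
  exact (Projectivization.mk_eq_mk_iff' ℂ _ _ _ _).2 ⟨(inner ℂ v p.rep)⁻¹, rfl⟩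

theorem inner_rep_mk_ne_zero_iff {y : HomCoord N} (hy : y ≠ 0) :
    inner ℂ v (Projectivization.mk ℂ y hy).rep ≠ 0 ↔ inner ℂ v y ≠ 0 := by
  obtain ⟨a, ha⟩ := Projectivization.exists_smul_eq_mk_rep ℂ y hy
  rw [← ha, Units.smul_def, inner_smul_right, mul_ne_zero_iff_left a.ne_zero]

theorem isLiftAt_affineRep {g : ℂ → CP N} {z : ℂ} (hg : IsHolomorphicCurve g)
    (hz : inner ℂ v (g z).rep ≠ 0) : IsLiftAt g z fun w => affineRep v (g w) := by
  obtain ⟨F, hF, hFg⟩ := hg z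
  have hvF : AnalyticAt ℂ (fun w => (inner ℂ v (F w) : ℂ)) z :=
    ((innerSL ℂ v).analyticAt _).comp hF
  have hvFz : inner ℂ v (F z) ≠ 0 := by
    obtain ⟨hFz, hgz⟩ := hFg.self_of_nhds
    rwa [hgz, inner_rep_mk_ne_zero_iff] at hz
  refine ⟨((hvF.inv hvFz).smul hF).congr ?_, ?_⟩
  · filter_upwards [hFg] with w ⟨hFw, hgw⟩
    rw [hgw, affineRep_mk, Pi.smul_apply', Pi.inv_apply]
  · filter_upwards [hFg, hvF.continuousAt.eventually_ne hvFz] with w ⟨hFw, hgw⟩ hvFw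
    have hw : inner ℂ v (g w).rep ≠ 0 := by rwa [hgw, inner_rep_mk_ne_zero_iff]
    exact ⟨affineRep_ne_zero hw, (mk_affineRep hw).symm⟩

theorem orthPart_affineRep (hv : ‖v‖ = 1) (hp : inner ℂ v p.rep ≠ 0) :
    orthPart v (affineRep v p) = affineRep v p - v := by
  simp [orthPart, inner_affineRep hp, hv]

theorem one_le_norm_affineRep (hv : ‖v‖ = 1) (hp : inner ℂ v p.rep ≠ 0) : 1 ≤ ‖affineRep v p‖ := by
  simpa [inner_affineRep hp, hv] using norm_inner_le_norm (𝕜 := ℂ) v (affineRep v p)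

theorem inner_rep_ne_zero (h : chordalDistCoord v p.rep < 1) : inner ℂ v p.rep ≠ 0 := fun h₀ => by
  have : chordalDistCoord v p.rep = 1 := by
    rw [chordalDistCoord, orthPart, h₀, zero_div, zero_smul, sub_zero,
      div_self (norm_ne_zero_iff.2 p.rep_nonzero)]
  linarith

theorem norm_affineRep_sub_le {s : ℝ} (hv : ‖v‖ = 1) (hs : s < 1)
    (h : chordalDistCoord v p.rep ≤ s) : ‖affineRep v p - v‖ ≤ s / (1 - s) := by
  have hp := inner_rep_ne_zero (h.trans_lt hs)
  have hchord : ‖affineRep v p - v‖ = chordalDistCoord v p.rep * ‖affineRep v p‖ := by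
    have hscale := chordalDistCoord_smul v p.rep one_ne_zero (inv_ne_zero hp)
    rw [one_smul, ← affineRep] at hscale
    rw [← hscale, chordalDistCoord_mul_norm v (affineRep_ne_zero hp), orthPart_affineRep hv hp]
  have hnorm : ‖affineRep v p‖ ≤ 1 + ‖affineRep v p - v‖ := by
    simpa [hv] using norm_add_le v (affineRep v p - v)
  have : 0 ≤ s := (chordalDistCoord_nonneg _ _).trans h
  have hle : ‖affineRep v p - v‖ ≤ s * (1 + ‖affineRep v p - v‖) := by
    conv_lhs => rw [hchord]
    gcongr
  rw [le_div_iff₀ (by linarith)]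
  linarith

theorem chordalDist_eq_affineRep (hp : inner ℂ v p.rep ≠ 0) (hq : inner ℂ v q.rep ≠ 0) :
    chordalDist p q = chordalDistCoord (affineRep v p) (affineRep v q) := by
  rw [← chordalDist_mk (affineRep_ne_zero hp) (affineRep_ne_zero hq), mk_affineRep hp,
    mk_affineRep hq]

theorem chordalDist_le_norm_affineRep_sub (hv : ‖v‖ = 1) (hp : inner ℂ v p.rep ≠ 0)
    (hq : inner ℂ v q.rep ≠ 0) : chordalDist p q ≤ ‖affineRep v q - affineRep v p‖ := by
  rw [chordalDist_eq_affineRep hp hq]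
  have h := chordalDistCoord_le_norm_sub_smul_div (affineRep v p) (affineRep v q) 1
  rw [one_smul] at h
  exact h.trans (div_le_self (norm_nonneg _) (one_le_norm_affineRep hv hq))

theorem norm_affineRep_sub_le_chordalDist (hv : ‖v‖ = 1) (hp : inner ℂ v p.rep ≠ 0)
    (hq : inner ℂ v q.rep ≠ 0) : ‖affineRep v q - affineRep v p‖ ≤
      (1 + ‖affineRep v p‖) * ‖affineRep v q‖ * chordalDist p q := by
  obtain ⟨c, hc, -⟩ := exists_orthPart_eq_sub_smul (affineRep v p) (affineRep v q)
  set D := orthPart (affineRep v p) (affineRep v q)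
  have hinner : inner ℂ v D = 1 - c := by
    rw [hc, inner_sub_right, inner_smul_right, inner_affineRep hp, inner_affineRep hq, mul_one]
  have hnormD : ‖D‖ = chordalDist p q * ‖affineRep v q‖ := by
    rw [chordalDist_eq_affineRep hp hq, chordalDistCoord_mul_norm _ (affineRep_ne_zero hq)]
  have hinner_le : ‖1 - c‖ ≤ ‖D‖ := by
    simpa [hinner, hv] using norm_inner_le_norm (𝕜 := ℂ) v D
  calc ‖affineRep v q - affineRep v p‖ = ‖D - (1 - c) • affineRep v p‖ := by
        rw [hc, sub_smul, one_smul]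
        congr 1
        abel
    _ ≤ ‖D‖ + ‖1 - c‖ * ‖affineRep v p‖ := by
        rw [← norm_smul]
        exact norm_sub_le _ _
    _ ≤ ‖D‖ + ‖D‖ * ‖affineRep v p‖ := by gcongr
    _ = _ := by
        rw [hnormD]
        ring

end AffineRep

/-! ### Separated sets -/

section Separated

variable {E : Type*} [NormedAddCommGroup E] [NormedSpace ℝ E] [FiniteDimensional ℝ E]
  [MeasurableSpace E] [BorelSpace E]

theorem integrable_inv_one_add_norm_pow (μ : Measure E) [μ.IsAddHaarMeasure] {n : ℕ}
    (hn : Module.finrank ℝ E < n) : Integrable (fun y : E => ((1 + ‖y‖) ^ n)⁻¹) μ := by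
  refine (integrable_one_add_norm (r := n) (Nat.cast_lt.2 hn)).congr (ae_of_all _ fun y => ?_)
  simp only [Real.rpow_neg (add_nonneg zero_le_one (norm_nonneg y)), Real.rpow_natCast]

theorem measureReal_ball_mul_inv_one_add_norm_pow_le (μ : Measure E) [μ.IsAddHaarMeasure] {n : ℕ}
    (hn : Module.finrank ℝ E < n) (x : E) :
    μ.real (Metric.ball 0 (1 / 2)) * ((1 + ‖x‖) ^ n)⁻¹ ≤
      (3 / 2) ^ n * ∫ y in Metric.ball x (1 / 2), ((1 + ‖y‖) ^ n)⁻¹ ∂μ := by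
  have hle : ∀ y ∈ Metric.ball x (1 / 2), ((1 + ‖x‖) ^ n)⁻¹ ≤ (3 / 2) ^ n * ((1 + ‖y‖) ^ n)⁻¹ := by
    intro y hy
    have hxy : ‖y‖ ≤ ‖x‖ + 1 / 2 := norm_le_norm_add_const_of_dist_le (Metric.mem_ball.1 hy).le
    rw [inv_le_iff_one_le_mul₀ (by positivity), mul_right_comm, ← mul_pow, ← div_eq_mul_inv,
      one_le_div (by positivity)]
    gcongr
    linarith [norm_nonneg x]
  have h := setIntegral_mono_on (μ := μ) (integrableOn_const measure_ball_lt_top.ne)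
    ((integrable_inv_one_add_norm_pow μ hn).integrableOn.const_mul _) measurableSet_ball hle
  rwa [setIntegral_const, integral_const_mul, Measure.real, Measure.addHaar_ball_center,
    smul_eq_mul] at h

theorem exists_sum_inv_one_add_norm_pow_le {n : ℕ} (hn : Module.finrank ℝ E < n) :
    ∃ C : ℝ, ∀ (ι : Type*) (T : Finset ι) (x : ι → E),
      (T : Set ι).Pairwise (fun i j => 1 ≤ dist (x i) (x j)) →
        ∑ i ∈ T, ((1 + ‖x i‖) ^ n)⁻¹ ≤ C := by
  set μ : Measure E := Measure.addHaar
  set φ : E → ℝ := fun y => ((1 + ‖y‖) ^ n)⁻¹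
  have hφ : Integrable φ μ := integrable_inv_one_add_norm_pow μ hn
  set V : ℝ := μ.real (Metric.ball 0 (1 / 2))
  have hV : 0 < V := ENNReal.toReal_pos (Metric.measure_ball_pos μ _ (by norm_num)).ne'
    measure_ball_lt_top.ne
  refine ⟨(3 / 2) ^ n * (∫ y, φ y ∂μ) / V, fun ι T x hT => ?_⟩
  have hdisj : (T : Set ι).Pairwise (Function.onFun Disjoint fun i => Metric.ball (x i) (1 / 2)) :=
    fun i hi j hj hij => Metric.ball_disjoint_ball (by linarith [hT hi hj hij])
  rw [le_div_iff₀' hV, Finset.mul_sum]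
  calc ∑ i ∈ T, V * φ (x i) ≤ ∑ i ∈ T, (3 / 2) ^ n * ∫ y in Metric.ball (x i) (1 / 2), φ y ∂μ :=
        Finset.sum_le_sum fun i _ => measureReal_ball_mul_inv_one_add_norm_pow_le μ hn (x i)
    _ = (3 / 2) ^ n * ∫ y in ⋃ i ∈ T, Metric.ball (x i) (1 / 2), φ y ∂μ := by
        rw [← Finset.mul_sum, integral_biUnion_finset T (fun _ _ => measurableSet_ball) hdisj
          fun _ _ => hφ.integrableOn]
    _ ≤ (3 / 2) ^ n * ∫ y, φ y ∂μ := by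
        gcongr
        · exact ae_of_all _ fun y => by positivity
        · exact Measure.restrict_le_self

theorem measure_iUnion_ball_inter_closedBall_le (μ : Measure E) [μ.IsAddHaarMeasure] {Λ : Set E}
    {R ρ : ℝ} (hR : 0 < R) (hΛ : Λ.Pairwise fun a b => R ≤ dist a b) (hρ : 0 < ρ) (c : E) (r : ℝ) :
    μ ((⋃ a ∈ Λ, Metric.ball a ρ) ∩ Metric.closedBall c r) ≤
      ENNReal.ofReal ((2 * ρ / R) ^ Module.finrank ℝ E) * μ (Metric.ball c (r + ρ + R / 2)) := by
  set Λ' : Set E := {a ∈ Λ | dist a c < r + ρ}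
  have hdisj : Λ'.PairwiseDisjoint fun a => Metric.ball a (R / 2) := fun a ha b hb hab =>
    Metric.ball_disjoint_ball (by linarith [hΛ ha.1 hb.1 hab])
  have hcount : Λ'.Countable := hdisj.countable_of_isOpen (fun _ _ => Metric.isOpen_ball)
    fun a _ => Metric.nonempty_ball.2 (half_pos hR)
  have hcover : (⋃ a ∈ Λ, Metric.ball a ρ) ∩ Metric.closedBall c r ⊆
      ⋃ a ∈ Λ', Metric.ball a ρ := by
    rintro z ⟨hz, hzc⟩
    obtain ⟨a, ha, hza⟩ := Set.mem_iUnion₂.1 hz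
    refine Set.mem_biUnion ⟨ha, ?_⟩ hza
    linarith [dist_triangle_left a c z, Metric.mem_ball.1 hza, Metric.mem_closedBall.1 hzc]
  have hscale (a : E) : μ (Metric.ball a ρ) =
      ENNReal.ofReal ((2 * ρ / R) ^ Module.finrank ℝ E) * μ (Metric.ball a (R / 2)) := by
    rw [μ.addHaar_ball_center a (R / 2), ← μ.addHaar_ball_mul_of_pos a (by positivity)]
    congr 2
    field_simp
  calc μ _ ≤ ∑' a : Λ', μ (Metric.ball (a : E) ρ) :=
        (measure_mono hcover).trans (measure_biUnion_le μ hcount _)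
    _ = ENNReal.ofReal ((2 * ρ / R) ^ Module.finrank ℝ E) *
          μ (⋃ a ∈ Λ', Metric.ball a (R / 2)) := by
        rw [measure_biUnion hcount hdisj fun _ _ => measurableSet_ball, ← ENNReal.tsum_mul_left]
        exact tsum_congr fun a => hscale a
    _ ≤ _ := by
        gcongr
        refine Set.iUnion₂_subset fun a ha => Metric.ball_subset_ball' ?_
        linarith [ha.2]

end Separated

theorem exists_subset_separated_forall_dist_le {X : Type*} [PseudoMetricSpace X] (Z : Set X)
    {R : ℝ} (hR : 0 ≤ R) :
    ∃ Λ ⊆ Z, Λ.Pairwise (fun a b => R ≤ dist a b) ∧ ∀ z ∈ Z, ∃ a ∈ Λ, dist z a ≤ R := by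
  obtain ⟨Λ, hΛ⟩ := zorn_subset {Λ : Set X | Λ ⊆ Z ∧ Λ.Pairwise fun a b => R ≤ dist a b}
    fun c hc hchain => ⟨⋃₀ c, ⟨Set.sUnion_subset fun s hs => (hc hs).1,
      (Set.pairwise_sUnion hchain.directedOn).2 fun s hs => (hc hs).2⟩,
      fun s hs => Set.subset_sUnion_of_mem hs⟩
  refine ⟨Λ, hΛ.prop.1, hΛ.prop.2, fun z hz => ?_⟩
  by_contra! hfar
  have hins : Λ.insert z ⊆ Z ∧ (Λ.insert z).Pairwise fun a b => R ≤ dist a b :=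
    ⟨Set.insert_subset hz hΛ.prop.1, hΛ.prop.2.insert fun b hb _ =>
      ⟨(hfar b hb).le, dist_comm z b ▸ (hfar b hb).le⟩⟩
  have hzΛ : z ∈ Λ := hΛ.le_of_ge hins (Set.subset_insert z Λ) (Set.mem_insert z Λ)
  exact (hfar z hzΛ).not_ge (by rwa [dist_self])

/-- The inverse cubes of the distances to the points of `Λ` at distance at least `r` sum to at most
`ε`, uniformly in the base point. The sums are formed over all subsets of `Λ` that avoid the disc,
so that single points may be discarded. -/
def HasTailBound (Λ : Set ℂ) (r ε : ℝ) : Prop :=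
  ∀ Λ' ⊆ Λ, ∀ w : ℂ, (∀ b ∈ Λ', r ≤ ‖w - b‖) →
    Summable (fun b : Λ' => (‖w - b‖ ^ 3)⁻¹) ∧ ∑' b : Λ', (‖w - b‖ ^ 3)⁻¹ ≤ ε

theorem exists_hasTailBound : ∃ C : ℝ, ∀ (Λ : Set ℂ) (R : ℝ), 0 < R →
    Λ.Pairwise (fun a b => R ≤ dist a b) → HasTailBound Λ (R / 4) (C / R ^ 3) := by
  obtain ⟨C, hC⟩ := exists_sum_inv_one_add_norm_pow_le (E := ℂ) (n := 3)
    (by rw [Complex.finrank_real_complex]; norm_num)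
  refine ⟨125 * C, fun Λ R hR hΛ Λ' hΛ' w hw => ?_⟩
  set x : Λ' → ℂ := fun b => R⁻¹ • (w - b)
  have hx (b : Λ') : ‖x b‖ = ‖w - b‖ / R := by
    rw [norm_smul, norm_inv, Real.norm_of_nonneg hR.le, inv_mul_eq_div]
  have hsep : Pairwise fun b c : Λ' => 1 ≤ dist (x b) (x c) := fun b c hbc => by
    simp only [x]
    rw [dist_smul₀, dist_sub_left, norm_inv, Real.norm_of_nonneg hR.le, inv_mul_eq_div,
      one_le_div hR]
    exact hΛ (hΛ' b.2) (hΛ' c.2) (Subtype.coe_ne_coe.2 hbc)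
  have hterm (b : Λ') : (‖w - b‖ ^ 3)⁻¹ ≤ 125 / R ^ 3 * ((1 + ‖x b‖) ^ 3)⁻¹ := by
    have hb := hw b b.2
    have : 0 < ‖w - b‖ := by linarith
    have hle : 1 + ‖x b‖ ≤ 5 / R * ‖w - b‖ := by
      rw [hx, div_mul_eq_mul_div, ← sub_nonneg]
      field_simp
      linarith
    calc (‖w - b‖ ^ 3)⁻¹ = 125 / R ^ 3 * ((5 / R * ‖w - b‖) ^ 3)⁻¹ := by
          field_simp
          norm_num
      _ ≤ _ := by gcongr
  have hsum (T : Finset Λ') : ∑ b ∈ T, (‖w - b‖ ^ 3)⁻¹ ≤ 125 * C / R ^ 3 := by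
    calc _ ≤ ∑ b ∈ T, 125 / R ^ 3 * ((1 + ‖x b‖) ^ 3)⁻¹ := Finset.sum_le_sum fun b _ => hterm b
      _ ≤ 125 / R ^ 3 * C := by
          rw [← Finset.mul_sum]
          gcongr
          exact hC Λ' T x (hsep.set_pairwise _)
      _ = _ := by ring
  exact ⟨summable_of_sum_le (fun b => by positivity) hsum, Real.tsum_le_of_sum_le
    (fun b => by positivity) hsum⟩

/-! ### Pole sums -/

section PoleSum

variable {E : Type*} [NormedAddCommGroup E] [NormedSpace ℂ E]

/-- The Mittag-Leffler series with a triple pole of leading coefficient `A b` at each `b ∈ Λ`. At a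
point `w ∈ Λ` the term of `w` itself is zero, as `0⁻¹ = 0`. -/
noncomputable def poleSum (A : ℂ → E) (Λ : Set ℂ) (w : ℂ) : E :=
  ∑' b : Λ, ((w - b) ^ 3)⁻¹ • A b

theorem HasTailBound.mono {Λ Λ' : Set ℂ} {r ε : ℝ} (h : HasTailBound Λ r ε) (hΛ' : Λ' ⊆ Λ) :
    HasTailBound Λ' r ε :=
  fun _ hs => h _ (hs.trans hΛ')

theorem HasTailBound.nonneg {Λ : Set ℂ} {r ε : ℝ} (h : HasTailBound Λ r ε) : 0 ≤ ε := by
  simpa using (h ∅ (Set.empty_subset Λ) 0 (by simp)).2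

theorem norm_sub_div_two_le_of_mem_ball {F : Type*} [SeminormedAddCommGroup F] {z w b : F} {r : ℝ}
    (hz : 2 * r ≤ ‖z - b‖) (hw : w ∈ Metric.ball z r) : ‖z - b‖ / 2 ≤ ‖w - b‖ := by
  have htri := norm_sub_le_norm_sub_add_norm_sub z w b
  rw [← dist_eq_norm z w, dist_comm] at htri
  linarith [Metric.mem_ball.1 hw]

variable {A : ℂ → E} {Λ : Set ℂ} {K r ε : ℝ}

theorem norm_pole_term_le (hA : ∀ b ∈ Λ, ‖A b‖ ≤ K) (w : ℂ) (b : Λ) :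
    ‖((w - b) ^ 3)⁻¹ • A b‖ ≤ K * (‖w - b‖ ^ 3)⁻¹ := by
  rw [norm_smul, norm_inv, norm_pow, mul_comm]
  gcongr
  exact hA b b.2

theorem norm_poleSum_le (hA : ∀ b ∈ Λ, ‖A b‖ ≤ K) (hK : 0 ≤ K) (hΛ : HasTailBound Λ r ε) {w : ℂ}
    (hw : ∀ b ∈ Λ, r ≤ ‖w - b‖) : ‖poleSum A Λ w‖ ≤ K * ε := by
  obtain ⟨hsum, hle⟩ := hΛ Λ subset_rfl w hw
  refine (tsum_of_norm_bounded (hsum.hasSum.mul_left K) (norm_pole_term_le hA w)).trans ?_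
  gcongr

theorem norm_deriv_le_of_forall_mem_ball {f : ℂ → E} {z : ℂ} (hr : 0 < r)
    (hf : DifferentiableOn ℂ f (Metric.ball z r)) (hK : ∀ w ∈ Metric.ball z r, ‖f w‖ ≤ K) :
    ‖deriv f z‖ ≤ 2 * K / r := by
  refine Complex.norm_deriv_le_div_of_mapsTo_ball hf (fun w hw => ?_) hr
  rw [mem_closedBall_iff_norm, two_mul]
  exact (norm_sub_le _ _).trans (add_le_add (hK w hw) (hK z (Metric.mem_ball_self hr)))

variable [CompleteSpace E]

theorem poleSum_eq_add (hA : ∀ b ∈ Λ, ‖A b‖ ≤ K) (hΛ : HasTailBound Λ r ε) {a w : ℂ}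
    (ha : a ∈ Λ) (hw : ∀ b ∈ Λ \ {a}, r ≤ ‖w - b‖) :
    poleSum A Λ w = ((w - a) ^ 3)⁻¹ • A a + poleSum A (Λ \ {a}) w := by
  have hsummable : Summable fun b : ↥(Λ \ {a}) => ((w - b) ^ 3)⁻¹ • A b :=
    .of_norm_bounded ((hΛ _ Set.sdiff_subset w hw).1.mul_left K)
      (norm_pole_term_le (fun b hb => hA b hb.1) w)
  have h := Summable.tsum_union_disjoint (f := fun b => ((w - b) ^ 3)⁻¹ • A b)
    (Set.disjoint_sdiff_right (s := {a}) (t := Λ)) ((Set.finite_singleton a).summable _) hsummable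
  rwa [tsum_singleton a fun b => ((w - b) ^ 3)⁻¹ • A b,
    Set.union_sdiff_cancel (Set.singleton_subset_iff.2 ha)] at h

theorem differentiableOn_poleSum (hA : ∀ b ∈ Λ, ‖A b‖ ≤ K) (hr : 0 < r)
    (hΛ : HasTailBound Λ r ε) {z : ℂ} (hz : ∀ b ∈ Λ, 2 * r ≤ ‖z - b‖) :
    DifferentiableOn ℂ (poleSum A Λ) (Metric.ball z r) := by
  have hpos : ∀ b ∈ Λ, 0 < ‖z - b‖ := fun b hb => by linarith [hz b hb]
  obtain ⟨hsum, -⟩ := hΛ Λ subset_rfl z fun b hb => by linarith [hz b hb]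
  refine Complex.differentiableOn_tsum_of_summable_norm (hsum.mul_left (8 * K)) (fun b w hw => ?_)
    Metric.isOpen_ball fun b w hw => ?_
  · have hwb : 0 < ‖w - b‖ :=
      (half_pos (hpos b b.2)).trans_le (norm_sub_div_two_le_of_mem_ball (hz b b.2) hw)
    have hinv : DifferentiableAt ℂ (fun w : ℂ => ((w - b) ^ 3)⁻¹) w :=
      .inv (by fun_prop) (pow_ne_zero 3 (norm_pos_iff.1 hwb))
    exact (hinv.smul_const _).differentiableWithinAt
  · have hwb := norm_sub_div_two_le_of_mem_ball (hz b b.2) hw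
    have := hpos b b.2
    have : 0 ≤ K := (norm_nonneg _).trans (hA b b.2)
    calc _ ≤ K * (‖w - b‖ ^ 3)⁻¹ := norm_pole_term_le hA w b
      _ ≤ K * ((‖z - b‖ / 2) ^ 3)⁻¹ := by gcongr
      _ = 8 * K * (‖z - b‖ ^ 3)⁻¹ := by
          field_simp
          norm_num

theorem norm_deriv_poleSum_le (hA : ∀ b ∈ Λ, ‖A b‖ ≤ K) (hK : 0 ≤ K) (hr : 0 < r)
    (hΛ : HasTailBound Λ r ε) {z : ℂ} (hz : ∀ b ∈ Λ, 2 * r ≤ ‖z - b‖) :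
    ‖deriv (poleSum A Λ) z‖ ≤ 2 * (K * ε) / r :=
  norm_deriv_le_of_forall_mem_ball hr (differentiableOn_poleSum hA hr hΛ hz) fun w hw =>
    norm_poleSum_le hA hK hΛ fun b hb => by
      linarith [hz b hb, norm_sub_div_two_le_of_mem_ball (hz b hb) hw]

end PoleSum

theorem analyticAt_clm_apply {E F : Type*} [NormedAddCommGroup E] [NormedSpace ℂ E]
    [NormedAddCommGroup F] [NormedSpace ℂ F] {A : ℂ → E →L[ℂ] F} {f : ℂ → E} {z : ℂ}
    (hA : AnalyticAt ℂ A z) (hf : AnalyticAt ℂ f z) : AnalyticAt ℂ (fun w => A w (f w)) z :=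
  ((ContinuousLinearMap.id ℂ (E →L[ℂ] F)).analyticAt_bilinear (A z, f z)).comp₂ hA hf

/-! ### The deformation -/

theorem add_norm_div_three_le_norm_add {E : Type*} [NormedAddCommGroup E] [InnerProductSpace ℂ E]
    {u v y : E} (hu : ‖u‖ = 1) (hv : ‖v‖ = 1) (hvu : inner ℂ v u = 0) (hy : ‖y - v‖ ≤ 1 / 3)
    (c d : ℂ) : (‖c‖ + ‖d‖) / 3 ≤ ‖c • y + d • u‖ := by
  have hpyth : ‖c • v + d • u‖ ^ 2 = ‖c‖ ^ 2 + ‖d‖ ^ 2 := by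
    rw [sq, norm_add_sq_eq_norm_sq_add_norm_sq_of_inner_eq_zero (𝕜 := ℂ) _ _
      (by rw [inner_smul_left, inner_smul_right, hvu, mul_zero, mul_zero])]
    simp only [norm_smul, hu, hv, mul_one, sq]
  have hmodel : 2 / 3 * (‖c‖ + ‖d‖) ≤ ‖c • v + d • u‖ := by
    refine le_of_sq_le_sq ?_ (norm_nonneg _)
    rw [hpyth]
    nlinarith [sq_nonneg (‖c‖ - ‖d‖)]
  have herr : ‖c • v - c • y‖ ≤ ‖c‖ / 3 := by
    rw [← smul_sub, norm_smul, norm_sub_rev, div_eq_mul_one_div]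
    gcongr
  have htri := norm_sub_norm_le (c • v + d • u) (c • y + d • u)
  rw [add_sub_add_right_eq_sub] at htri
  linarith [norm_nonneg d]

/-- The data of the deformation: poles at mutual distances at least `R`, each with an orthonormal
pair `v`, `u` of directions in homogeneous coordinates; the deformation pushes a curve away from
`[v b]` through `[u b]` near the pole `b`. The number `ε` bounds the deviation of the deforming
operators from the identity far from the poles; `8000` is the size of the residues. -/
structure PoleConfig (N : ℕ) (R ε : ℝ) where
  poles : Set ℂ
  v : ℂ → HomCoord N
  u : ℂ → HomCoord N
  norm_v : ∀ b, ‖v b‖ = 1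
  norm_u : ∀ b, ‖u b‖ = 1
  inner_v_u : ∀ b, inner ℂ (v b) (u b) = 0
  separated : poles.Pairwise fun a b => R ≤ dist a b
  tail : HasTailBound poles (R / 4) (ε / 8000)
  large : 100 ≤ R
  small : ε ≤ 1 / 100000

namespace PoleConfig

variable {R ε : ℝ} (D : PoleConfig N R ε)

/-- The coefficient `8000 u_b ⟨v_b, ·⟩` of the pole `b` in the deforming operators. -/
noncomputable def residue (b : ℂ) : HomCoord N →L[ℂ] HomCoord N :=
  (8000 : ℂ) • InnerProductSpace.rankOne ℂ (D.u b) (D.v b)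

/-- The meromorphic field of operators on homogeneous coordinates that deforms curves. -/
noncomputable def op (w : ℂ) : HomCoord N →L[ℂ] HomCoord N := 1 + poleSum D.residue D.poles w

/-- The contribution to `op` of the poles other than `a`. -/
noncomputable def err (a w : ℂ) : HomCoord N →L[ℂ] HomCoord N :=
  poleSum D.residue (D.poles \ {a}) w

/-- The operator field `op` multiplied by `(w - a) ^ 3`, which makes it holomorphic near the
pole `a`. -/
noncomputable def regOp (a w : ℂ) : HomCoord N →L[ℂ] HomCoord N :=
  (w - a) ^ 3 • (1 + D.err a w) + D.residue a

open Classical in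
/-- The leading coefficient of the operator field at a point: its value away from the poles, and
the residue at a pole. -/
noncomputable def leadOp (w : ℂ) : HomCoord N →L[ℂ] HomCoord N :=
  if w ∈ D.poles then D.residue w else D.op w

open Classical in
/-- The deformed curve `[A · g]`, where `A` is the operator field of the configuration. Points that
the operator annihilates are left in place; this does not happen for admissible curves. -/
noncomputable def deform (g : ℂ → CP N) (z : ℂ) : CP N :=
  if h : D.leadOp z (g z).rep ≠ 0 then .mk ℂ _ h else g z

/-- The curves that stay close to the direction `v a` on the disk of radius `R` around each
pole `a`. -/
structure Admissible (g : ℂ → CP N) : Prop where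
  holo : IsHolomorphicCurve g
  near : ∀ a ∈ D.poles, ∀ z, ‖z - a‖ ≤ R → chordalDistCoord (D.v a) (g z).rep ≤ 1 / 5

/-- The component along `v a` of the natural lift of the deformed curve near the pole `a`, with the
factor `(w - a) ^ 3` removed: the affine representative of the curve, perturbed by the other
poles. -/
noncomputable def perturbedRep (g : ℂ → CP N) (a w : ℂ) : HomCoord N :=
  (1 + D.err a w) (affineRep (D.v a) (g w))

include D in
theorem eps_nonneg : 0 ≤ ε := by linarith [D.tail.nonneg]

theorem residue_apply (b : ℂ) (x : HomCoord N) :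
    D.residue b x = (8000 * inner ℂ (D.v b) x : ℂ) • D.u b := by
  rw [residue, smul_apply, InnerProductSpace.rankOne_apply, smul_smul]

theorem norm_residue (b : ℂ) : ‖D.residue b‖ = 8000 := by
  rw [residue, norm_smul, InnerProductSpace.norm_rankOne, D.norm_u, D.norm_v]
  norm_num

theorem norm_poleSum_residue_le {Λ : Set ℂ} (hΛ : Λ ⊆ D.poles) {w : ℂ}
    (hw : ∀ b ∈ Λ, R / 4 ≤ ‖w - b‖) : ‖poleSum D.residue Λ w‖ ≤ ε := by
  simpa [mul_div_cancel₀] using norm_poleSum_le (fun b _ => (D.norm_residue b).le) (by norm_num)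
    (D.tail.mono hΛ) hw

theorem differentiableOn_poleSum_residue {Λ : Set ℂ} (hΛ : Λ ⊆ D.poles) {z : ℂ}
    (hz : ∀ b ∈ Λ, R / 2 ≤ ‖z - b‖) :
    DifferentiableOn ℂ (poleSum D.residue Λ) (Metric.ball z (R / 4)) :=
  differentiableOn_poleSum (fun b _ => (D.norm_residue b).le) (by linarith [D.large])
    (D.tail.mono hΛ) fun b hb => by linarith [hz b hb]

theorem analyticAt_poleSum_residue {Λ : Set ℂ} (hΛ : Λ ⊆ D.poles) {z : ℂ}
    (hz : ∀ b ∈ Λ, R / 2 ≤ ‖z - b‖) : AnalyticAt ℂ (poleSum D.residue Λ) z :=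
  (D.differentiableOn_poleSum_residue hΛ hz).analyticAt
    (Metric.ball_mem_nhds z (by linarith [D.large]))

theorem sub_norm_sub_le {a b : ℂ} (ha : a ∈ D.poles) (hb : b ∈ D.poles \ {a}) (z : ℂ) :
    R - ‖z - a‖ ≤ ‖z - b‖ := by
  have htri := dist_triangle a z b
  rw [dist_comm a z, dist_eq_norm z, dist_eq_norm z] at htri
  linarith [D.separated ha hb.1 (Ne.symm hb.2)]

theorem outer_or_inner (z : ℂ) :
    (∀ b ∈ D.poles, R / 2 ≤ ‖z - b‖) ∨ ∃ a ∈ D.poles, ‖z - a‖ < R / 2 := by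
  by_cases! h : ∀ b ∈ D.poles, R / 2 ≤ ‖z - b‖
  exacts [.inl h, .inr h]

theorem leadOp_of_notMem {z : ℂ} (hz : z ∉ D.poles) : D.leadOp z = D.op z := if_neg hz

theorem deform_eq_mk {g : ℂ → CP N} {z c : ℂ} {M : HomCoord N →L[ℂ] HomCoord N} {x : HomCoord N}
    (hc : c ≠ 0) (hM : M = c • D.leadOp z) (hx : x ≠ 0) (hg : g z = .mk ℂ x hx) (hMx : M x ≠ 0) :
    D.deform g z = .mk ℂ (M x) hMx := by
  obtain ⟨a, ha⟩ := Projectivization.exists_smul_eq_mk_rep ℂ x hx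
  have hrep : D.leadOp z (g z).rep = (a * c⁻¹ : ℂ) • M x := by
    rw [hM, smul_apply, smul_smul, mul_assoc, inv_mul_cancel₀ hc, mul_one, hg,
      ← ha, Units.smul_def, map_smul]
  have hne : D.leadOp z (g z).rep ≠ 0 := by
    rw [hrep]
    exact smul_ne_zero (mul_ne_zero a.ne_zero (inv_ne_zero hc)) hMx
  rw [deform, dif_pos hne]
  exact (Projectivization.mk_eq_mk_iff' ℂ _ _ _ _).2 ⟨_, hrep.symm⟩

section Outer

variable {z : ℂ} (hz : ∀ b ∈ D.poles, R / 4 ≤ ‖z - b‖)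
include hz

theorem leadOp_eq_op : D.leadOp z = D.op z :=
  D.leadOp_of_notMem fun h => by
    have := hz z h
    rw [sub_self, norm_zero] at this
    linarith [D.large]

theorem norm_op_le : ‖D.op z‖ ≤ 1 + ε :=
  (norm_add_le _ _).trans <|
    add_le_add ContinuousLinearMap.norm_id_le (D.norm_poleSum_residue_le subset_rfl hz)

theorem mul_norm_le_norm_op (x : HomCoord N) : (1 - ε) * ‖x‖ ≤ ‖D.op z x‖ := by
  have hsum := (poleSum D.residue D.poles z).le_of_opNorm_le
    (D.norm_poleSum_residue_le subset_rfl hz) x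
  have hop : D.op z x = x + poleSum D.residue D.poles z x := rfl
  have htri := norm_sub_le_norm_add x (poleSum D.residue D.poles z x)
  rw [← hop] at htri
  linarith

theorem op_ne_zero {x : HomCoord N} (hx : x ≠ 0) : D.op z x ≠ 0 := by
  have hm : 0 < 1 - ε := by linarith [D.small]
  exact norm_pos_iff.1 ((mul_pos hm (norm_pos_iff.2 hx)).trans_le (D.mul_norm_le_norm_op hz x))

end Outer

theorem isLiftAt_deform_of_outer {g : ℂ → CP N} {z : ℂ} {F : ℂ → HomCoord N} (hF : IsLiftAt g z F)
    (hz : ∀ b ∈ D.poles, R / 2 ≤ ‖z - b‖) :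
    IsLiftAt (D.deform g) z fun w => D.op w (F w) := by
  have hop : AnalyticAt ℂ D.op z :=
    analyticAt_const.add (D.analyticAt_poleSum_residue subset_rfl hz)
  refine ⟨analyticAt_clm_apply hop hF.1, ?_⟩
  filter_upwards [hF.2, Metric.ball_mem_nhds z (by linarith [D.large] : 0 < R / 4)]
    with w ⟨hFw, hgw⟩ hw
  have hw' : ∀ b ∈ D.poles, R / 4 ≤ ‖w - b‖ := fun b hb => by
    linarith [hz b hb, norm_sub_div_two_le_of_mem_ball (b := b) (by linarith [hz b hb]) hw]
  exact ⟨D.op_ne_zero hw' hFw, D.deform_eq_mk one_ne_zero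
    (by rw [one_smul, D.leadOp_eq_op hw']) hFw hgw _⟩

section Near

variable {a : ℂ} (ha : a ∈ D.poles)
include ha

theorem norm_err_le {z : ℂ} (hz : ‖z - a‖ ≤ 3 * R / 4) : ‖D.err a z‖ ≤ ε :=
  D.norm_poleSum_residue_le Set.sdiff_subset fun b hb => by linarith [D.sub_norm_sub_le ha hb z]

theorem differentiableOn_err {z : ℂ} (hz : ‖z - a‖ ≤ R / 2) :
    DifferentiableOn ℂ (D.err a) (Metric.ball z (R / 4)) :=
  D.differentiableOn_poleSum_residue Set.sdiff_subset fun b hb => by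
    linarith [D.sub_norm_sub_le ha hb z]

theorem op_eq_add {z : ℂ} (hz : ‖z - a‖ ≤ 3 * R / 4) :
    D.op z = ((z - a) ^ 3)⁻¹ • D.residue a + (1 + D.err a z) := by
  rw [op, poleSum_eq_add (fun b _ => (D.norm_residue b).le) D.tail ha
    fun b hb => by linarith [D.sub_norm_sub_le ha hb z], err]
  abel

theorem exists_regOp_eq_smul_leadOp {z : ℂ} (hz : ‖z - a‖ ≤ 3 * R / 4) :
    ∃ c : ℂ, c ≠ 0 ∧ D.regOp a z = c • D.leadOp z := by
  rcases eq_or_ne z a with rfl | hza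
  · refine ⟨1, one_ne_zero, ?_⟩
    have hzero : (z - z) ^ 3 • (1 + D.err z z) = 0 := by
      rw [sub_self, zero_pow three_ne_zero]
      exact zero_smul ℂ (1 + D.err z z)
    rw [regOp, hzero, zero_add, one_smul, leadOp, if_pos ha]
  · have hc : (z - a) ^ 3 ≠ 0 := pow_ne_zero 3 (sub_ne_zero.2 hza)
    have hz' : z ∉ D.poles := fun h => by
      have := D.sub_norm_sub_le ha ⟨h, hza⟩ z
      rw [sub_self, norm_zero] at this
      linarith [D.large]
    refine ⟨_, hc, ?_⟩
    rw [D.leadOp_of_notMem hz', D.op_eq_add ha hz, smul_add, smul_inv_smul₀ hc]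
    exact add_comm _ _

end Near

section Admissible

variable {D} {g : ℂ → CP N} {a z : ℂ} (hg : D.Admissible g) (ha : a ∈ D.poles)
include hg ha

theorem Admissible.inner_rep_ne_zero (hz : ‖z - a‖ ≤ R) : inner ℂ (D.v a) (g z).rep ≠ 0 :=
  Brody.inner_rep_ne_zero ((hg.near a ha z hz).trans_lt (by norm_num))

theorem Admissible.norm_affineRep_sub_le (hz : ‖z - a‖ ≤ R) :
    ‖affineRep (D.v a) (g z) - D.v a‖ ≤ 1 / 4 :=
  (Brody.norm_affineRep_sub_le (D.norm_v a) (by norm_num) (hg.near a ha z hz)).trans (by norm_num)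

theorem Admissible.norm_affineRep_le (hz : ‖z - a‖ ≤ R) : ‖affineRep (D.v a) (g z)‖ ≤ 5 / 4 := by
  linarith [norm_sub_norm_le (affineRep (D.v a) (g z)) (D.v a), D.norm_v a,
    hg.norm_affineRep_sub_le ha hz]

theorem Admissible.analyticAt_affineRep (hz : ‖z - a‖ ≤ R) :
    AnalyticAt ℂ (fun w => affineRep (D.v a) (g w)) z :=
  (isLiftAt_affineRep hg.holo (hg.inner_rep_ne_zero ha hz)).1

theorem Admissible.norm_perturbedRep_sub_le (hz : ‖z - a‖ ≤ 3 * R / 4) :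
    ‖D.perturbedRep g a z - D.v a‖ ≤ 1 / 3 := by
  have hzR : ‖z - a‖ ≤ R := by linarith [norm_nonneg (z - a)]
  have herr := (D.err a z).le_of_opNorm_le ((D.norm_err_le ha hz).trans D.small)
    (affineRep (D.v a) (g z))
  have hsub : D.perturbedRep g a z - D.v a =
      (affineRep (D.v a) (g z) - D.v a) + D.err a z (affineRep (D.v a) (g z)) :=
    add_sub_right_comm _ _ _
  rw [hsub]
  linarith [norm_add_le (affineRep (D.v a) (g z) - D.v a)
    (D.err a z (affineRep (D.v a) (g z))), hg.norm_affineRep_sub_le ha hzR,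
    hg.norm_affineRep_le ha hzR]

theorem Admissible.differentiableOn_perturbedRep (hz : ‖z - a‖ ≤ R / 2) :
    DifferentiableOn ℂ (D.perturbedRep g a) (Metric.ball z (R / 4)) := by
  refine ((differentiableOn_const 1).add (D.differentiableOn_err ha hz)).clm_apply fun w hw =>
    (hg.analyticAt_affineRep ha ?_).differentiableAt.differentiableWithinAt
  linarith [norm_sub_le_norm_sub_add_norm_sub w z a, mem_ball_iff_norm.1 hw, norm_nonneg (z - a)]

theorem Admissible.regOp_affineRep (hz : ‖z - a‖ ≤ R) :
    D.regOp a z (affineRep (D.v a) (g z)) =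
      (z - a) ^ 3 • D.perturbedRep g a z + (8000 : ℂ) • D.u a := by
  rw [regOp, add_apply, residue_apply,
    inner_affineRep (hg.inner_rep_ne_zero ha hz), mul_one]
  rfl

theorem Admissible.le_norm_regOp (hz : ‖z - a‖ ≤ 3 * R / 4) :
    (‖z - a‖ ^ 3 + 8000) / 3 ≤ ‖D.regOp a z (affineRep (D.v a) (g z))‖ := by
  rw [hg.regOp_affineRep ha (by linarith [norm_nonneg (z - a)])]
  have h := add_norm_div_three_le_norm_add (D.norm_u a) (D.norm_v a) (D.inner_v_u a)
    (hg.norm_perturbedRep_sub_le ha hz) ((z - a) ^ 3) 8000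
  rwa [norm_pow, RCLike.norm_ofNat] at h

theorem Admissible.regOp_affineRep_ne_zero (hz : ‖z - a‖ ≤ 3 * R / 4) :
    D.regOp a z (affineRep (D.v a) (g z)) ≠ 0 :=
  norm_pos_iff.1 ((by positivity : (0 : ℝ) < (‖z - a‖ ^ 3 + 8000) / 3).trans_le
    (hg.le_norm_regOp ha hz))

theorem Admissible.deform_eq_mk_regOp (hz : ‖z - a‖ ≤ 3 * R / 4) :
    D.deform g z = .mk ℂ _ (hg.regOp_affineRep_ne_zero ha hz) := by
  obtain ⟨c, hc, hreg⟩ := D.exists_regOp_eq_smul_leadOp ha hz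
  exact D.deform_eq_mk hc hreg _
    (mk_affineRep (hg.inner_rep_ne_zero ha (by linarith [norm_nonneg (z - a)]))).symm _

theorem Admissible.isLiftAt_deform (hz : ‖z - a‖ < R / 2) :
    IsLiftAt (D.deform g) z fun w => (w - a) ^ 3 • D.perturbedRep g a w + (8000 : ℂ) • D.u a := by
  refine ⟨(((analyticAt_id.sub analyticAt_const).pow 3).smul
    ((hg.differentiableOn_perturbedRep ha hz.le).analyticAt
      (Metric.ball_mem_nhds z (by linarith [D.large])))).add analyticAt_const, ?_⟩
  have hnear : ∀ᶠ w in 𝓝 z, ‖w - a‖ < R / 2 :=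
    (by fun_prop : Continuous fun w : ℂ => ‖w - a‖).continuousAt.eventually_lt continuousAt_const hz
  filter_upwards [hnear] with w hw
  have hw' : ‖w - a‖ ≤ 3 * R / 4 := by linarith [norm_nonneg (w - a)]
  have hlift := hg.regOp_affineRep ha (z := w) (by linarith [norm_nonneg (w - a)])
  refine ⟨hlift ▸ hg.regOp_affineRep_ne_zero ha hw', ?_⟩
  simp only [hg.deform_eq_mk_regOp ha hw', hlift]

end Admissible

theorem Admissible.isHolomorphicCurve_deform {D : PoleConfig N R ε} {g : ℂ → CP N}
    (hg : D.Admissible g) : IsHolomorphicCurve (D.deform g) := fun z => by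
  rcases D.outer_or_inner z with h | ⟨a, ha, hz⟩
  · exact ⟨_, D.isLiftAt_deform_of_outer (hg.holo z).choose_spec h⟩
  · exact ⟨_, hg.isLiftAt_deform ha hz⟩

end PoleConfig

/-! ### The speed of the deformed curve -/

theorem norm_deriv_div_norm_cube_smul_add_le {E : Type*} [NormedAddCommGroup E]
    [InnerProductSpace ℂ E] {u v : E} {Y : ℂ → E} {a z : ℂ} {δ : ℝ} (hu : ‖u‖ = 1) (hv : ‖v‖ = 1)
    (hvu : inner ℂ v u = 0) (hYd : DifferentiableAt ℂ Y z) (hY : ‖Y z - v‖ ≤ 1 / 3)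
    (hY' : ‖deriv Y z‖ ≤ δ) {c : ℂ} (hc : c ≠ 0) :
    ‖deriv (fun w => (w - a) ^ 3 • Y w + c • u) z‖ / ‖(z - a) ^ 3 • Y z + c • u‖ ≤
      12 * ‖z - a‖ ^ 2 / (‖z - a‖ ^ 3 + ‖c‖) + 3 * δ := by
  have hderiv : deriv (fun w => (w - a) ^ 3 • Y w + c • u) z =
      (z - a) ^ 3 • deriv Y z + (3 * (z - a) ^ 2) • Y z := by
    simpa using ((((hasDerivAt_id z).sub_const a).pow 3).smul hYd.hasDerivAt |>.add_const
      (c • u)).deriv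
  have hlow := add_norm_div_three_le_norm_add hu hv hvu hY ((z - a) ^ 3) c
  have hYn : ‖Y z‖ ≤ 4 / 3 := by linarith [norm_sub_norm_le (Y z) v]
  have : 0 ≤ δ := (norm_nonneg _).trans hY'
  have : 0 < ‖c‖ := norm_pos_iff.2 hc
  rw [norm_pow] at hlow
  set r := ‖z - a‖
  have : 0 ≤ r := norm_nonneg _
  calc _ ≤ (r ^ 3 * δ + 3 * r ^ 2 * (4 / 3)) / ((r ^ 3 + ‖c‖) / 3) := by
        rw [hderiv]
        gcongr
        refine (norm_add_le _ _).trans ?_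
        simp only [norm_smul, norm_mul, norm_pow, RCLike.norm_ofNat]
        gcongr
    _ = 12 * r ^ 2 / (r ^ 3 + ‖c‖) + 3 * δ * (r ^ 3 / (r ^ 3 + ‖c‖)) := by
        field_simp
        ring
    _ ≤ _ := by
        have hfrac : r ^ 3 / (r ^ 3 + ‖c‖) ≤ 1 := (div_le_one (by positivity)).2 (by linarith)
        exact add_le_add le_rfl (mul_le_of_le_one_right (by positivity) hfrac)

namespace PoleConfig

variable {R ε : ℝ} (D : PoleConfig N R ε)

theorem abs_speed_deform_sub_le {g : ℂ → CP N} {z : ℂ} {F : ℂ → HomCoord N} (hF : IsLiftAt g z F)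
    (hz : ∀ b ∈ D.poles, R / 2 ≤ ‖z - b‖) :
    |speed (D.deform g) z - fsNorm (D.op z (F z)) (D.op z (deriv F z))| ≤ 9 * ε / R := by
  have hR := D.large
  have hε := D.eps_nonneg
  have hz' : ∀ b ∈ D.poles, R / 4 ≤ ‖z - b‖ := fun b hb => by linarith [hz b hb]
  set S := poleSum D.residue D.poles
  have hS : ‖deriv S z‖ ≤ 8 * ε / R := by
    refine (norm_deriv_poleSum_le (fun b _ => (D.norm_residue b).le) (by norm_num)
      (by positivity) D.tail fun b hb => by linarith [hz b hb]).trans_eq ?_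
    field_simp
    ring
  have hderiv : deriv (fun w => D.op w (F w)) z = D.op z (deriv F z) + deriv S z (F z) :=
    (((D.analyticAt_poleSum_residue subset_rfl hz).differentiableAt.hasDerivAt.const_add
      1).clm_apply hF.1.differentiableAt.hasDerivAt).deriv.trans (add_comm _ _)
  have herr : fsNorm (D.op z (F z)) (deriv S z (F z)) ≤ 9 * ε / R := by
    have hF₀ : 0 < ‖F z‖ := norm_pos_iff.2 hF.ne_zero
    have hm : 0 < 1 - ε := by linarith [D.small]
    calc _ ≤ ‖deriv S z (F z)‖ / ‖D.op z (F z)‖ := fsNorm_le_norm_div _ _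
      _ ≤ 8 * ε / R * ‖F z‖ / ((1 - ε) * ‖F z‖) := by
          gcongr
          exacts [(deriv S z).le_of_opNorm_le hS _, D.mul_norm_le_norm_op hz' _]
      _ = 8 / (1 - ε) * (ε / R) := by field_simp
      _ ≤ 9 * (ε / R) := by
          gcongr
          rw [div_le_iff₀ hm]
          linarith [D.small]
      _ = _ := by ring
  rw [speed_eq (D.isLiftAt_deform_of_outer hF hz), hderiv]
  exact (abs_fsNorm_add_sub_le _ _ _).trans herr

theorem speed_deform_le_of_outer {g : ℂ → CP N} (hg : IsHolomorphicCurve g) {z : ℂ}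
    (hz : ∀ b ∈ D.poles, R / 2 ≤ ‖z - b‖) :
    speed (D.deform g) z ≤ (1 + 3 * ε) * speed g z + ε := by
  obtain ⟨F, hF⟩ := hg z
  have hz' : ∀ b ∈ D.poles, R / 4 ≤ ‖z - b‖ := fun b hb => by linarith [hz b hb, D.large]
  have hm : 0 < 1 - ε := by linarith [D.small]
  have hmap := fsNorm_map_le (D.op z) hm (D.norm_op_le hz') hF.ne_zero (D.mul_norm_le_norm_op hz' _)
    (deriv F z)
  have hratio : (1 + ε) / (1 - ε) ≤ 1 + 3 * ε := by
    rw [div_le_iff₀ hm]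
    nlinarith [D.small, D.eps_nonneg]
  have hsmall : 9 * ε / R ≤ ε := by
    rw [div_le_iff₀ (by linarith [D.large])]
    nlinarith [D.large, D.eps_nonneg]
  rw [speed_eq hF]
  linarith [(abs_le.1 (D.abs_speed_deform_sub_le hF hz)).2,
    mul_le_mul_of_nonneg_right hratio (fsNorm_nonneg (F z) (deriv F z))]

theorem le_speed_deform_of_outer {g : ℂ → CP N} (hg : IsHolomorphicCurve g) {z : ℂ}
    (hz : ∀ b ∈ D.poles, R / 2 ≤ ‖z - b‖) :
    (1 - 2 * ε) * speed g z - 9 * ε / R ≤ speed (D.deform g) z := by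
  obtain ⟨F, hF⟩ := hg z
  have hz' : ∀ b ∈ D.poles, R / 4 ≤ ‖z - b‖ := fun b hb => by linarith [hz b hb, D.large]
  have hm : 0 < 1 - ε := by linarith [D.small]
  have hmap := div_mul_fsNorm_le_map (D.op z) hm (D.mul_norm_le_norm_op hz')
    (D.norm_op_le hz') hF.ne_zero (deriv F z)
  have hratio : 1 - 2 * ε ≤ (1 - ε) / (1 + ε) := by
    rw [le_div_iff₀ (by linarith [D.eps_nonneg])]
    nlinarith [D.eps_nonneg]
  rw [speed_eq hF]
  linarith [(abs_le.1 (D.abs_speed_deform_sub_le hF hz)).1,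
    mul_le_mul_of_nonneg_right hratio (fsNorm_nonneg (F z) (deriv F z))]

section Admissible

variable {D} {g : ℂ → CP N} {a z : ℂ} (hg : D.Admissible g) (ha : a ∈ D.poles)
  (hz : ‖z - a‖ < R / 2)
include hg ha hz

theorem Admissible.norm_deriv_perturbedRep_le : ‖deriv (D.perturbedRep g a) z‖ ≤ 8 / 3 / R := by
  have hR := D.large
  rw [← deriv_sub_const (D.v a)]
  refine (norm_deriv_le_of_forall_mem_ball (K := 1 / 3) (by positivity)
    ((hg.differentiableOn_perturbedRep ha hz.le).sub_const _) fun w hw =>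
      hg.norm_perturbedRep_sub_le ha ?_).trans_eq (by field_simp; norm_num)
  linarith [norm_sub_le_norm_sub_add_norm_sub w z a, mem_ball_iff_norm.1 hw]

theorem Admissible.speed_deform_le :
    speed (D.deform g) z ≤ 12 * ‖z - a‖ ^ 2 / (‖z - a‖ ^ 3 + 8000) + 8 / R := by
  have hR := D.large
  have hY := ((hg.differentiableOn_perturbedRep ha hz.le).differentiableAt
    (Metric.ball_mem_nhds z (by positivity)))
  rw [speed_eq (hg.isLiftAt_deform ha hz)]
  refine (fsNorm_le_norm_div _ _).trans ((norm_deriv_div_norm_cube_smul_add_le (D.norm_u a)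
    (D.norm_v a) (D.inner_v_u a) hY (hg.norm_perturbedRep_sub_le ha (by linarith))
    (hg.norm_deriv_perturbedRep_le ha hz) (by norm_num)).trans_eq ?_)
  rw [RCLike.norm_ofNat]
  ring

theorem Admissible.speed_deform_le_one : speed (D.deform g) z ≤ 1 := by
  have hmodel : 12 * ‖z - a‖ ^ 2 / (‖z - a‖ ^ 3 + 8000) ≤ 3 / 5 := by
    have hr := norm_nonneg (z - a)
    rw [div_le_iff₀ (by positivity)]
    nlinarith [mul_nonneg hr (sq_nonneg (‖z - a‖ - 20)), sq_nonneg (‖z - a‖ - 20)]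
  have herr : 8 / R ≤ 8 / 100 := by
    gcongr
    exact D.large
  linarith [hg.speed_deform_le ha hz]

theorem Admissible.speed_deform_le_of_le {ρ : ℝ} (hρ : 0 < ρ) (hρz : ρ ≤ ‖z - a‖) :
    speed (D.deform g) z ≤ 12 / ρ + 8 / R := by
  refine (hg.speed_deform_le ha hz).trans (add_le_add_left ?_ _)
  have : 0 < ‖z - a‖ := hρ.trans_le hρz
  calc _ ≤ 12 * ‖z - a‖ ^ 2 / ‖z - a‖ ^ 3 := by
        gcongr
        linarith
    _ = 12 / ‖z - a‖ := by field_simp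
    _ ≤ _ := by gcongr

end Admissible

end PoleConfig

/-! ### Distances between deformed curves -/

theorem norm_sq_mul_norm_le_of_map_map_eq_zero {𝕜 E : Type*} [NontriviallyNormedField 𝕜]
    [NormedAddCommGroup E] [NormedSpace 𝕜 E] {P : E →L[𝕜] E} {x : E} (hP : P (P x) = 0) (t : 𝕜) :
    ‖t‖ ^ 2 * ‖x‖ ≤ (‖t‖ + ‖P‖) * ‖t • x + P x‖ := by
  have hx : t ^ 2 • x = t • (t • x + P x) - P (t • x + P x) := by
    rw [map_add, map_smul, hP, smul_add, smul_smul, ← sq]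
    abel
  calc ‖t‖ ^ 2 * ‖x‖ = ‖t • (t • x + P x) - P (t • x + P x)‖ := by
        rw [← hx, norm_smul, norm_pow]
    _ ≤ ‖t‖ * ‖t • x + P x‖ + ‖P‖ * ‖t • x + P x‖ := by
        refine (norm_sub_le _ _).trans (add_le_add (norm_smul _ _).le (P.le_opNorm _))
    _ = _ := by ring

namespace PoleConfig

variable {R ε : ℝ} {D : PoleConfig N R ε}

theorem norm_regOp_le {a z : ℂ} (ha : a ∈ D.poles) (hz : ‖z - a‖ ≤ 3 * R / 4) :
    ‖D.regOp a z‖ ≤ (1 + ε) * (‖z - a‖ ^ 3 + 8000) := by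
  have hε := D.eps_nonneg
  have herr : ‖1 + D.err a z‖ ≤ 1 + ε :=
    (norm_add_le _ _).trans (add_le_add ContinuousLinearMap.norm_id_le (D.norm_err_le ha hz))
  calc ‖D.regOp a z‖ ≤ ‖z - a‖ ^ 3 * (1 + ε) + 8000 := by
        refine (norm_add_le _ _).trans (add_le_add ?_ (D.norm_residue a).le)
        rw [norm_smul, norm_pow]
        gcongr
    _ ≤ _ := by linarith

theorem norm_cube_div_mul_norm_le_norm_regOp {a z : ℂ} (ha : a ∈ D.poles)
    (hz : ‖z - a‖ ≤ 3 * R / 4) (hz₁ : 1 ≤ ‖z - a‖) (x : HomCoord N) :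
    ‖z - a‖ ^ 3 / 9000 * ‖x‖ ≤ ‖D.regOp a z x‖ := by
  have hres : D.residue a (D.residue a x) = 0 := by
    rw [residue_apply, residue_apply, inner_smul_right, D.inner_v_u, mul_zero, mul_zero, zero_smul]
  have hnil := norm_sq_mul_norm_le_of_map_map_eq_zero hres ((z - a) ^ 3)
  have herr := (D.err a z).le_of_opNorm_le ((D.norm_err_le ha hz).trans D.small) x
  have hreg : (z - a) ^ 3 • x + D.residue a x =
      D.regOp a z x - (z - a) ^ 3 • D.err a z x := by
    change _ = (z - a) ^ 3 • (x + D.err a z x) + D.residue a x - _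
    rw [smul_add]
    abel
  have htri := norm_sub_le (D.regOp a z x) ((z - a) ^ 3 • D.err a z x)
  rw [← hreg, norm_smul, norm_pow] at htri
  rw [norm_residue, norm_pow] at hnil
  have ht : 1 ≤ ‖z - a‖ ^ 3 := one_le_pow₀ hz₁
  generalize ‖z - a‖ ^ 3 = t at *
  have hbound : t ^ 2 * ‖x‖ ≤
      8001 * t * (‖D.regOp a z x‖ + t * (1 / 100000 * ‖x‖)) :=
    hnil.trans (mul_le_mul (by linarith) (htri.trans (by gcongr)) (norm_nonneg _) (by positivity))
  have : t * ‖x‖ ≤ 8001 * (‖D.regOp a z x‖ + t * (1 / 100000 * ‖x‖)) :=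
    le_of_mul_le_mul_left (by linarith) (by linarith : 0 < t)
  linarith [mul_nonneg (by linarith : 0 ≤ t) (norm_nonneg x)]

theorem chordalDist_deform_of_outer (g₁ g₂ : ℂ → CP N) {z : ℂ}
    (hz : ∀ b ∈ D.poles, R / 4 ≤ ‖z - b‖) :
    chordalDist (D.deform g₁ z) (D.deform g₂ z) =
      chordalDistCoord (D.op z (g₁ z).rep) (D.op z (g₂ z).rep) := by
  have hmk : ∀ g : ℂ → CP N, D.deform g z = .mk ℂ _ (D.op_ne_zero hz (g z).rep_nonzero) :=
    fun g => D.deform_eq_mk one_ne_zero (by rw [one_smul, D.leadOp_eq_op hz]) (g z).rep_nonzero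
      (Projectivization.mk_rep _).symm _
  rw [hmk, hmk, chordalDist_mk]

section Admissible

variable {g₁ g₂ : ℂ → CP N} (hg₁ : D.Admissible g₁) (hg₂ : D.Admissible g₂)
include hg₁ hg₂

section Near

variable {a z : ℂ} (ha : a ∈ D.poles)
include ha

theorem Admissible.chordalDist_eq_affineRep (hz : ‖z - a‖ ≤ R) :
    chordalDist (g₁ z) (g₂ z) =
      chordalDistCoord (affineRep (D.v a) (g₁ z)) (affineRep (D.v a) (g₂ z)) :=
  Brody.chordalDist_eq_affineRep (hg₁.inner_rep_ne_zero ha hz) (hg₂.inner_rep_ne_zero ha hz)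

theorem Admissible.chordalDist_deform_eq (hz : ‖z - a‖ ≤ 3 * R / 4) :
    chordalDist (D.deform g₁ z) (D.deform g₂ z) = chordalDistCoord
      (D.regOp a z (affineRep (D.v a) (g₁ z))) (D.regOp a z (affineRep (D.v a) (g₂ z))) := by
  rw [hg₁.deform_eq_mk_regOp ha hz, hg₂.deform_eq_mk_regOp ha hz, chordalDist_mk]

theorem Admissible.norm_affineRep_sub_le_chordalDist (hz : ‖z - a‖ ≤ R) :
    ‖affineRep (D.v a) (g₂ z) - affineRep (D.v a) (g₁ z)‖ ≤ 3 * chordalDist (g₁ z) (g₂ z) := by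
  refine (Brody.norm_affineRep_sub_le_chordalDist (D.norm_v a) (hg₁.inner_rep_ne_zero ha hz)
    (hg₂.inner_rep_ne_zero ha hz)).trans (mul_le_mul_of_nonneg_right ?_ (chordalDist_nonneg _ _))
  calc _ ≤ (1 + 5 / 4) * (5 / 4 : ℝ) := by
        gcongr
        exacts [hg₁.norm_affineRep_le ha hz, hg₂.norm_affineRep_le ha hz]
    _ ≤ 3 := by norm_num

end Near

theorem Admissible.chordalDist_deform_le (z : ℂ) :
    chordalDist (D.deform g₁ z) (D.deform g₂ z) ≤ 5 * chordalDist (g₁ z) (g₂ z) := by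
  have hε := D.small
  rcases D.outer_or_inner z with h | ⟨a, ha, h⟩
  · have h' : ∀ b ∈ D.poles, R / 4 ≤ ‖z - b‖ := fun b hb => by linarith [h b hb, D.large]
    rw [chordalDist_deform_of_outer g₁ g₂ h']
    refine (chordalDistCoord_map_le (D.op z) (by linarith) (D.norm_op_le h') _
      (g₂ z).rep_nonzero (D.mul_norm_le_norm_op h' _)).trans
      (mul_le_mul_of_nonneg_right ?_ (chordalDist_nonneg _ _))
    rw [div_le_iff₀ (by linarith)]
    linarith
  · have hz : ‖z - a‖ ≤ 3 * R / 4 := by linarith [norm_nonneg (z - a)]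
    have hzR : ‖z - a‖ ≤ R := by linarith [norm_nonneg (z - a)]
    have hm : 4 / 15 * (‖z - a‖ ^ 3 + 8000) * ‖affineRep (D.v a) (g₂ z)‖ ≤
        ‖D.regOp a z (affineRep (D.v a) (g₂ z))‖ :=
      calc _ ≤ 4 / 15 * (‖z - a‖ ^ 3 + 8000) * (5 / 4) := by
            gcongr
            exact hg₂.norm_affineRep_le ha hzR
        _ ≤ _ := by linarith [hg₂.le_norm_regOp ha hz]
    rw [hg₁.chordalDist_deform_eq hg₂ ha hz, hg₁.chordalDist_eq_affineRep hg₂ ha hzR]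
    refine (chordalDistCoord_map_le (D.regOp a z) (by positivity) (norm_regOp_le ha hz) _
      (affineRep_ne_zero (hg₂.inner_rep_ne_zero ha hzR)) hm).trans
      (mul_le_mul_of_nonneg_right ?_ (chordalDistCoord_nonneg _ _))
    rw [div_le_iff₀ (by positivity)]
    nlinarith [pow_nonneg (norm_nonneg (z - a)) 3]

theorem Admissible.chordalDist_le_deform {z : ℂ} (hz : ∀ b ∈ D.poles, 1 ≤ ‖z - b‖) :
    chordalDist (g₁ z) (g₂ z) ≤ 81000000 * chordalDist (D.deform g₁ z) (D.deform g₂ z) := by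
  have hε := D.small
  rcases D.outer_or_inner z with h | ⟨a, ha, h⟩
  · have h' : ∀ b ∈ D.poles, R / 4 ≤ ‖z - b‖ := fun b hb => by linarith [h b hb, D.large]
    rw [chordalDist_deform_of_outer g₁ g₂ h']
    refine (chordalDistCoord_le_map (D.op z) (by linarith) (D.mul_norm_le_norm_op h')
      (D.norm_op_le h') _ (g₂ z).rep_nonzero).trans
      (mul_le_mul_of_nonneg_right ?_ (chordalDistCoord_nonneg _ _))
    rw [div_le_iff₀ (by linarith)]
    linarith
  · have hz₃ : ‖z - a‖ ≤ 3 * R / 4 := by linarith [norm_nonneg (z - a)]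
    have hzR : ‖z - a‖ ≤ R := by linarith [norm_nonneg (z - a)]
    have ht : 1 ≤ ‖z - a‖ ^ 3 := one_le_pow₀ (hz a ha)
    rw [hg₁.chordalDist_deform_eq hg₂ ha hz₃, hg₁.chordalDist_eq_affineRep hg₂ ha hzR]
    refine (chordalDistCoord_le_map (D.regOp a z) (by positivity)
      (norm_cube_div_mul_norm_le_norm_regOp ha hz₃ (hz a ha)) (norm_regOp_le ha hz₃) _
      (affineRep_ne_zero (hg₂.inner_rep_ne_zero ha hzR))).trans
      (mul_le_mul_of_nonneg_right ?_ (chordalDistCoord_nonneg _ _))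
    rw [div_le_iff₀ (by positivity)]
    nlinarith

-- Near a pole the lower bound degenerates; it is recovered from the unit circle around the pole
-- by the maximum principle for the difference of the affine representatives.
theorem Admissible.norm_affineRep_sub_le_of_sphere {a : ℂ} (ha : a ∈ D.poles) {s : ℝ}
    (hs : ∀ w ∈ Metric.sphere a 1, chordalDist (D.deform g₁ w) (D.deform g₂ w) ≤ s) {z : ℂ}
    (hz : z ∈ Metric.closedBall a 1) :
    ‖affineRep (D.v a) (g₂ z) - affineRep (D.v a) (g₁ z)‖ ≤ 243000000 * s := by
  have hR := D.large
  refine Complex.norm_le_of_forall_mem_frontier_norm_le (U := Metric.ball a 1)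
    (f := fun w => affineRep (D.v a) (g₂ w) - affineRep (D.v a) (g₁ w)) Metric.isBounded_ball
    (DifferentiableOn.diffContOnCl fun w hw => ?_) (fun w hw => ?_)
    (by rwa [closure_ball a one_ne_zero])
  · rw [closure_ball a one_ne_zero, mem_closedBall_iff_norm] at hw
    exact ((hg₂.analyticAt_affineRep ha (by linarith)).sub
      (hg₁.analyticAt_affineRep ha (by linarith))).differentiableAt.differentiableWithinAt
  · rw [frontier_ball a one_ne_zero] at hw
    have hwa : ‖w - a‖ = 1 := mem_sphere_iff_norm.1 hw
    have hfar : ∀ b ∈ D.poles, 1 ≤ ‖w - b‖ := fun b hb => by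
      rcases eq_or_ne b a with rfl | hba
      exacts [hwa.ge, by linarith [D.sub_norm_sub_le ha ⟨hb, hba⟩ w]]
    linarith [hg₁.norm_affineRep_sub_le_chordalDist hg₂ ha (z := w) (by linarith),
      hg₁.chordalDist_le_deform hg₂ hfar, hs w hw]

theorem Admissible.chordalDist_le_of_forall_deform_le {s : ℝ} (z : ℂ)
    (hs : ∀ w, ‖w - z‖ ≤ 3 → chordalDist (D.deform g₁ w) (D.deform g₂ w) ≤ s) :
    chordalDist (g₁ z) (g₂ z) ≤ 243000000 * s := by
  have hsz := hs z (by simp)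
  by_cases! hz : ∀ b ∈ D.poles, 1 ≤ ‖z - b‖
  · linarith [hg₁.chordalDist_le_deform hg₂ hz, chordalDist_nonneg (D.deform g₁ z) (D.deform g₂ z)]
  obtain ⟨a, ha, hza⟩ := hz
  have hzR : ‖z - a‖ ≤ R := by linarith [D.large]
  refine (chordalDist_le_norm_affineRep_sub (D.norm_v a) (hg₁.inner_rep_ne_zero ha hzR)
    (hg₂.inner_rep_ne_zero ha hzR)).trans (hg₁.norm_affineRep_sub_le_of_sphere hg₂ ha
      (fun w hw => hs w ?_) (mem_closedBall_iff_norm.2 hza.le))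
  linarith [norm_sub_le_norm_sub_add_norm_sub w a z, mem_sphere_iff_norm.1 hw, norm_sub_rev a z]

theorem Admissible.dFS_deform_le (z : ℂ) :
    dFS (D.deform g₁ z) (D.deform g₂ z) ≤ 10 * dFS (g₁ z) (g₂ z) := by
  linarith [dFS_le_chordalDist (D.deform g₁ z) (D.deform g₂ z),
    hg₁.chordalDist_deform_le hg₂ z, chordalDist_le_two_mul_dFS (g₁ z) (g₂ z)]

theorem Admissible.dFS_le_iSup_deform (z : ℂ) :
    dFS (g₁ z) (g₂ z) ≤
      486000000 * ⨆ w : Metric.closedBall z 3, dFS (D.deform g₁ w) (D.deform g₂ w) := by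
  set s := ⨆ w : Metric.closedBall z 3, dFS (D.deform g₁ w) (D.deform g₂ w)
  have hle : ∀ w, ‖w - z‖ ≤ 3 → dFS (D.deform g₁ w) (D.deform g₂ w) ≤ s := fun w hw =>
    le_ciSup (bddAbove_range_dFS (fun w : Metric.closedBall z 3 => D.deform g₁ w)
      fun w => D.deform g₂ w) ⟨w, mem_closedBall_iff_norm.2 hw⟩
  have hchord : ∀ w, ‖w - z‖ ≤ 3 → chordalDist (D.deform g₁ w) (D.deform g₂ w) ≤ 2 * s :=
    fun w hw => by
      linarith [chordalDist_le_two_mul_dFS (D.deform g₁ w) (D.deform g₂ w), hle w hw]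
  linarith [dFS_le_chordalDist (g₁ z) (g₂ z), hg₁.chordalDist_le_of_forall_deform_le hg₂ z hchord]

end Admissible

end PoleConfig

/-! ### Slow disks and nondegeneracy -/

/-- The centres of the disks of radius `R` on which `f` is slow; these are the places where a
deformation has to create speed. -/
def slowCenters (R : ℝ) (f : ℂ → CP N) : Set ℂ :=
  {a | ∀ z, ‖z - a‖ ≤ R → speed f z < 1 / (20 * R)}

theorem norm_inner_div_norm_le_chordalDistCoord {u v : HomCoord N} (hv : ‖v‖ = 1)
    (hvu : inner ℂ v u = 0) (x : HomCoord N) : ‖inner ℂ v x‖ / ‖x‖ ≤ chordalDistCoord u x := by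
  obtain ⟨c, hc, -⟩ := exists_orthPart_eq_sub_smul u x
  have hinner : inner ℂ v (orthPart u x) = inner ℂ v x := by
    rw [hc, inner_sub_right, inner_smul_right, hvu, mul_zero, sub_zero]
  rw [chordalDistCoord]
  gcongr
  simpa [hinner, hv] using norm_inner_le_norm (𝕜 := ℂ) v (orthPart u x)

theorem norm_div_le_chordalDistCoord_smul_add {v w y : HomCoord N} (hv : ‖v‖ = 1)
    (hvw : inner ℂ v w = 0) (hy : ‖y - v‖ ≤ 1 / 3) {t : ℂ} (ht : t ≠ 0) :
    2 * ‖t‖ / (4 * ‖t‖ + 3 * ‖w‖) ≤ chordalDistCoord w (t • y + w) := by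
  have : 0 < ‖t‖ := norm_pos_iff.2 ht
  have hinner : 2 / 3 * ‖t‖ ≤ ‖inner ℂ v (t • y + w)‖ := by
    have hsplit : inner ℂ v (t • y + w) = t * (1 + inner ℂ v (y - v)) := by
      rw [inner_add_right, inner_smul_right, hvw, inner_sub_right, inner_self_eq_norm_sq_to_K, hv]
      simp
    have herr := norm_inner_le_norm (𝕜 := ℂ) v (y - v)
    rw [hv, one_mul] at herr
    have htri := norm_sub_le_norm_add (1 : ℂ) (inner ℂ v (y - v))
    rw [norm_one] at htri
    rw [hsplit, norm_mul, mul_comm]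
    gcongr
    linarith
  have hnorm : ‖t • y + w‖ ≤ 4 / 3 * ‖t‖ + ‖w‖ := by
    have hyn : ‖y‖ ≤ 4 / 3 := by linarith [norm_sub_norm_le y v]
    refine (norm_add_le _ _).trans (add_le_add_left ?_ _)
    rw [norm_smul, mul_comm]
    gcongr
  have hpos : 0 < ‖t • y + w‖ :=
    ((by positivity : 0 < 2 / 3 * ‖t‖).trans_le hinner).trans_le
      ((norm_inner_le_norm _ _).trans_eq (by rw [hv, one_mul]))
  calc _ = 2 / 3 * ‖t‖ / (4 / 3 * ‖t‖ + ‖w‖) := by field_simp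
    _ ≤ ‖inner ℂ v (t • y + w)‖ / ‖t • y + w‖ := by gcongr
    _ ≤ _ := norm_inner_div_norm_le_chordalDistCoord hv hvw _

namespace PoleConfig

variable {R ε : ℝ} {D : PoleConfig N R ε}

theorem v_ne_zero (D : PoleConfig N R ε) (b : ℂ) : D.v b ≠ 0 := by
  rw [← norm_ne_zero_iff, D.norm_v]
  exact one_ne_zero

/-- A configuration is adapted to `f` if its poles are slow centres of `f` within distance `R` of
every slow centre, and the direction at each pole is the value of `f` there. -/
structure Adapted (D : PoleConfig N R ε) (f : ℂ → CP N) : Prop where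
  poles_subset : D.poles ⊆ slowCenters R f
  cover : ∀ z ∈ slowCenters R f, ∃ a ∈ D.poles, ‖z - a‖ ≤ R
  mk_v : ∀ a, .mk ℂ (D.v a) (D.v_ne_zero a) = f a

variable {f : ℂ → CP N}

theorem Adapted.chordalDistCoord_v (hD : D.Adapted f) (a : ℂ) (p : CP N) :
    chordalDistCoord (D.v a) p.rep = chordalDist (f a) p := by
  rw [← hD.mk_v a, ← chordalDist_mk (D.v_ne_zero a) p.rep_nonzero, p.mk_rep]

theorem Adapted.admissible (hD : D.Adapted f) (hf : f ∈ BrodyCurves N) {g : ℂ → CP N}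
    (hg : g ∈ brodyBall (1 / 20) f) : D.Admissible g where
  holo := hg.1.1
  near a ha z hz := by
    have hR := D.large
    have hslow := chordalDist_le_of_speed_le hf.1 fun w (hw : ‖w - a‖ ≤ ‖z - a‖) =>
      (hD.poles_subset ha w (hw.trans hz)).le
    have hdisk : 2 * (1 / (20 * R)) * ‖z - a‖ ≤ 1 / 10 :=
      calc _ ≤ 2 * (1 / (20 * R)) * R := by gcongr
        _ = 1 / 10 := by field_simp; norm_num
    rw [hD.chordalDistCoord_v]
    linarith [chordalDist_triangle (f a) (f z) (g z), chordalDist_le_two_mul_dFS (f z) (g z),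
      dFS_le_dC f g z, hg.2]

theorem Adapted.outer_of_le_speed (hD : D.Adapted f) {z : ℂ} (hz : 1 / (20 * R) ≤ speed f z) :
    ∀ b ∈ D.poles, R / 2 ≤ ‖z - b‖ := fun b hb => by
  by_contra! hlt
  exact hz.not_gt (hD.poles_subset hb z (by linarith [D.large]))

theorem Admissible.le_chordalDist_deform (hf : D.Admissible f) {a : ℂ} (ha : a ∈ D.poles) :
    9 / 20 ≤ chordalDist (D.deform f a) (D.deform f (a + 40)) := by
  have hR := D.large
  have ha₀ : ‖a - a‖ ≤ 3 * R / 4 := by rw [sub_self, norm_zero]; linarith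
  have hz : ‖a + 40 - a‖ ≤ 3 * R / 4 := by rw [add_sub_cancel_left, RCLike.norm_ofNat]; linarith
  have hmove := norm_div_le_chordalDistCoord_smul_add (w := (8000 : ℂ) • D.u a) (t := 64000)
    (D.norm_v a) (by rw [inner_smul_right, D.inner_v_u, mul_zero])
    (hf.norm_perturbedRep_sub_le ha hz) (by norm_num)
  rw [norm_smul, D.norm_u, RCLike.norm_ofNat, RCLike.norm_ofNat] at hmove
  rw [hf.deform_eq_mk_regOp ha ha₀, hf.deform_eq_mk_regOp ha hz, chordalDist_mk,
    hf.regOp_affineRep ha (by linarith), hf.regOp_affineRep ha (by linarith), sub_self,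
    zero_pow three_ne_zero, zero_smul, zero_add, add_sub_cancel_left]
  norm_num at hmove ⊢
  linarith

theorem Admissible.exists_le_speed_deform (hf : D.Admissible f) {a : ℂ} (ha : a ∈ D.poles) :
    ∃ z, ‖z - a‖ ≤ 40 ∧ 1 / 200 ≤ speed (D.deform f) z := by
  by_contra! h
  have hr : ‖a + 40 - a‖ = 40 := by simp
  have hle := chordalDist_le_of_speed_le hf.isHolomorphicCurve_deform (a := a) (z := a + 40)
    fun w hw => (h w (hr ▸ hw)).le
  rw [hr] at hle
  linarith [hf.le_chordalDist_deform ha]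

theorem Adapted.isNondegenerate_deform (hD : D.Adapted f) (hf : D.Admissible f) :
    IsNondegenerate (25 * R) (D.deform f) := by
  intro c
  have hR := D.large
  have hε := D.small
  by_cases! hc : ∀ z, ‖z - c‖ ≤ R → speed f z < 1 / (20 * R)
  · obtain ⟨a, ha, hca⟩ := hD.cover c hc
    obtain ⟨z, hza, hz⟩ := hf.exists_le_speed_deform ha
    refine ⟨z, ?_, (one_div_le_one_div_of_le (by norm_num) (by linarith)).trans hz⟩
    linarith [norm_sub_le_norm_sub_add_norm_sub z a c, norm_sub_rev a c]
  · obtain ⟨w, hwc, hw⟩ := hc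
    refine ⟨w, by linarith, le_trans ?_ (D.le_speed_deform_of_outer hf.holo
      (hD.outer_of_le_speed hw))⟩
    calc 1 / (25 * R) ≤ (1 - 2 * ε) * (1 / (20 * R)) - 9 * ε / R := by
          rw [← sub_nonneg]
          have : (1 - 2 * ε) * (1 / (20 * R)) - 9 * ε / R - 1 / (25 * R) =
            (1 / 100 - 91 / 10 * ε) / R := by field_simp; ring
          rw [this]
          exact div_nonneg (by linarith) (by linarith)
      _ ≤ _ := by
          gcongr
          linarith

end PoleConfig

/-! ### Energy over squares -/

theorem abs_sq_sub_sq_le {x y d B : ℝ} (hx : 0 ≤ x) (hy : 0 ≤ y) (hB : x + y ≤ B)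
    (h : |x - y| ≤ d) : |x ^ 2 - y ^ 2| ≤ B * d := by
  rw [sq_sub_sq, abs_mul, abs_of_nonneg (add_nonneg hx hy)]
  exact mul_le_mul hB h (abs_nonneg _) ((add_nonneg hx hy).trans hB)

theorem abs_setIntegral_sub_setIntegral_le {α : Type*} [MeasurableSpace α] {μ : Measure α}
    {f g : α → ℝ} {S B : Set α} {e : ℝ} (hS : μ S ≠ ⊤) (hB : MeasurableSet B)
    (hf : IntegrableOn f S μ) (hg : IntegrableOn g S μ)
    (h : ∀ x, |f x - g x| ≤ e + B.indicator (fun _ => 1) x) :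
    |(∫ x in S, f x ∂μ) - ∫ x in S, g x ∂μ| ≤ e * μ.real S + μ.real (B ∩ S) := by
  have he : IntegrableOn (fun _ => e) S μ := integrableOn_const hS
  have hind : IntegrableOn (B.indicator fun _ => (1 : ℝ)) S μ :=
    (integrableOn_const hS).indicator hB
  calc _ = |∫ x in S, (f x - g x) ∂μ| := by rw [integral_sub hf hg]
    _ ≤ ∫ x in S, |f x - g x| ∂μ := abs_integral_le_integral_abs
    _ ≤ ∫ x in S, (e + B.indicator (fun _ => 1) x) ∂μ :=
        setIntegral_mono (hf.sub hg).abs (he.add hind) h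
    _ = _ := by
        rw [integral_add he hind, setIntegral_const, smul_eq_mul, mul_comm,
          integral_indicator_const _ hB, measureReal_restrict_apply hB, smul_eq_mul, mul_one]

theorem isCompact_square (a u : ℂ) (L : ℝ) : IsCompact (square a u L) := by
  have himage : square a u L =
      (fun p : ℝ × ℝ => a + u * (p.1 + p.2 * Complex.I)) '' Set.Icc 0 L ×ˢ Set.Icc 0 L := by
    ext z
    constructor
    · rintro ⟨x, hx, y, hy, rfl⟩
      exact ⟨(x, y), ⟨hx, hy⟩, rfl⟩
    · rintro ⟨⟨x, y⟩, ⟨hx, hy⟩, rfl⟩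
      exact ⟨x, hx, y, hy, rfl⟩
  rw [himage]
  exact (isCompact_Icc.prod isCompact_Icc).image (by fun_prop)

theorem square_subset_closedBall {a u : ℂ} (hu : ‖u‖ = 1) (L : ℝ) :
    square a u L ⊆ Metric.closedBall a (2 * L) := by
  rintro z ⟨x, hx, y, hy, rfl⟩
  rw [mem_closedBall_iff_norm, add_sub_cancel_left, norm_mul, hu, one_mul]
  refine (norm_add_le _ _).trans ?_
  rw [norm_mul, Complex.norm_I, mul_one, Complex.norm_of_nonneg hx.1, Complex.norm_of_nonneg hy.1]
  linarith [hx.2, hy.2]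

theorem volumeReal_ball_le (c : ℂ) {r : ℝ} (hr : 0 ≤ r) :
    volume.real (Metric.ball c r) ≤ 13 / 4 * r ^ 2 := by
  rw [Measure.real, Complex.volume_ball, ENNReal.toReal_mul, ENNReal.toReal_pow,
    ENNReal.toReal_ofReal hr, ENNReal.coe_toReal, NNReal.coe_real_pi, mul_comm]
  gcongr
  linarith [Real.pi_lt_d2]

theorem volumeReal_square_le {a u : ℂ} (hu : ‖u‖ = 1) {L : ℝ} (hL : 0 ≤ L) :
    volume.real (square a u L) ≤ 13 * L ^ 2 :=
  calc _ ≤ volume.real (Metric.closedBall a (2 * L)) :=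
        measureReal_mono (square_subset_closedBall hu L) measure_closedBall_lt_top.ne
    _ = volume.real (Metric.ball a (2 * L)) :=
        Measure.addHaar_real_closedBall_eq_addHaar_real_ball _ _ _
    _ ≤ 13 / 4 * (2 * L) ^ 2 := volumeReal_ball_le a (by positivity)
    _ = _ := by ring

theorem volumeReal_iUnion_ball_inter_square_le {Λ : Set ℂ} {R ρ L : ℝ} (hR : 0 < R)
    (hΛ : Λ.Pairwise fun a b => R ≤ dist a b) (hρ : 0 < ρ) (hρR : ρ ≤ R) (hL : R ≤ L) {a u : ℂ}
    (hu : ‖u‖ = 1) :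
    volume.real ((⋃ b ∈ Λ, Metric.ball b ρ) ∩ square a u L) ≤ 208 * ρ ^ 2 / R ^ 2 * L ^ 2 := by
  have hvol := ENNReal.toReal_mono (by finiteness)
    (measure_iUnion_ball_inter_closedBall_le volume hR hΛ hρ a (2 * L))
  rw [ENNReal.toReal_mul, ENNReal.toReal_ofReal (by positivity), Complex.finrank_real_complex]
    at hvol
  calc _ ≤ volume.real ((⋃ b ∈ Λ, Metric.ball b ρ) ∩ Metric.closedBall a (2 * L)) :=
        measureReal_mono (Set.inter_subset_inter_right _ (square_subset_closedBall hu L))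
          (measure_inter_lt_top_of_right_ne_top measure_closedBall_lt_top.ne).ne
    _ ≤ (2 * ρ / R) ^ 2 * volume.real (Metric.ball a (2 * L + ρ + R / 2)) := hvol
    _ ≤ (2 * ρ / R) ^ 2 * volume.real (Metric.ball a (4 * L)) := by
        gcongr
        · exact measure_ball_lt_top.ne
        · linarith
    _ ≤ (2 * ρ / R) ^ 2 * (13 / 4 * (4 * L) ^ 2) := by
        gcongr
        exact volumeReal_ball_le a (by linarith)
    _ = _ := by ring

namespace PoleConfig

variable {R ε : ℝ} {D : PoleConfig N R ε} {f : ℂ → CP N}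

theorem abs_speed_sub_speed_deform_le (hf : f ∈ BrodyCurves N) {z : ℂ}
    (hz : ∀ b ∈ D.poles, R / 2 ≤ ‖z - b‖) : |speed f z - speed (D.deform f) z| ≤ 4 * ε := by
  have hε := D.eps_nonneg
  have hsmall : 9 * ε / R ≤ ε := by
    rw [div_le_iff₀ (by linarith [D.large])]
    nlinarith [D.large]
  have hspeed := mul_le_mul_of_nonneg_left (hf.2 z) hε
  rw [abs_le]
  constructor <;>
    linarith [D.speed_deform_le_of_outer hf.1 hz, D.le_speed_deform_of_outer hf.1 hz]

theorem Admissible.deform_mem_lipCurves (hadm : D.Admissible f) (hf : f ∈ BrodyCurves N) :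
    D.deform f ∈ LipCurves N (1 + 4 * ε) := by
  refine ⟨hadm.isHolomorphicCurve_deform, fun z => ?_⟩
  rcases D.outer_or_inner z with h | ⟨a, ha, h⟩
  · linarith [hf.2 z, (abs_le.1 (abs_speed_sub_speed_deform_le hf h)).1]
  · linarith [hadm.speed_deform_le_one ha h, D.eps_nonneg]

theorem Adapted.abs_sq_speed_sub_le (hD : D.Adapted f) (hf : f ∈ BrodyCurves N)
    (hadm : D.Admissible f) {ρ : ℝ} (hρ : 0 < ρ) (z : ℂ) :
    |speed f z ^ 2 - speed (D.deform f) z ^ 2| ≤ 12 * ε + 12 / ρ + 8 / R +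
      (⋃ a ∈ D.poles, Metric.ball a ρ).indicator (fun _ => (1 : ℝ)) z := by
  have hR := D.large
  have hε := D.eps_nonneg
  have hf₀ := speed_nonneg f z
  have hd₀ := speed_nonneg (D.deform f) z
  have hf₁ := hf.2 z
  have hind : 0 ≤ (⋃ a ∈ D.poles, Metric.ball a ρ).indicator (fun _ => (1 : ℝ)) z :=
    Set.indicator_nonneg (fun _ _ => zero_le_one) z
  have hpos : 0 ≤ 12 / ρ + 8 / R := by positivity
  rcases D.outer_or_inner z with h | ⟨a, ha, h⟩
  · have hdiff := abs_speed_sub_speed_deform_le hf h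
    have hsum : speed f z + speed (D.deform f) z ≤ 3 := by
      linarith [(abs_le.1 hdiff).1, D.small]
    linarith [abs_sq_sub_sq_le hf₀ hd₀ hsum hdiff]
  have hd₁ := hadm.speed_deform_le_one ha h
  rcases lt_or_ge ‖z - a‖ ρ with hlt | hge
  · rw [Set.indicator_of_mem (Set.mem_biUnion ha (mem_ball_iff_norm.2 hlt)), abs_le]
    constructor <;> nlinarith
  · have hd := hadm.speed_deform_le_of_le ha h hρ hge
    have hfs : speed f z ≤ 12 / ρ + 8 / R :=
      calc speed f z ≤ 1 / (20 * R) := (hD.poles_subset ha z (by linarith)).le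
        _ ≤ 8 / R := by gcongr <;> linarith
        _ ≤ _ := le_add_of_nonneg_left (by positivity)
    rw [abs_le]
    constructor <;> nlinarith

theorem Adapted.abs_energy_sub_le (hD : D.Adapted f) (hf : f ∈ BrodyCurves N)
    (hadm : D.Admissible f) {ρ : ℝ} (hρ : 0 < ρ) (hρR : ρ ≤ R) {a u : ℂ} (hu : ‖u‖ = 1) {L : ℝ}
    (hL : R ≤ L) :
    |(∫ z in square a u L, speed f z ^ 2) - ∫ z in square a u L, speed (D.deform f) z ^ 2| ≤
      (13 * (12 * ε + 12 / ρ + 8 / R) + 208 * ρ ^ 2 / R ^ 2) * L ^ 2 := by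
  have hR : 0 < R := hρ.trans_le hρR
  have := D.eps_nonneg
  have hS := isCompact_square a u L
  have hint {g : ℂ → CP N} (hg : IsHolomorphicCurve g) :
      IntegrableOn (fun z => speed g z ^ 2) (square a u L) :=
    ((continuous_speed hg).pow 2).continuousOn.integrableOn_compact hS
  refine (abs_setIntegral_sub_setIntegral_le hS.measure_lt_top.ne
    (isOpen_biUnion fun _ _ => Metric.isOpen_ball).measurableSet (hint hf.1)
    (hint hadm.isHolomorphicCurve_deform) (hD.abs_sq_speed_sub_le hf hadm hρ)).trans ?_
  calc _ ≤ (12 * ε + 12 / ρ + 8 / R) * (13 * L ^ 2) + 208 * ρ ^ 2 / R ^ 2 * L ^ 2 := by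
        gcongr
        exacts [volumeReal_square_le hu (hR.le.trans hL),
          volumeReal_iUnion_ball_inter_square_le hR D.separated hρ hρR hL hu]
    _ = _ := by ring

end PoleConfig

/-! ### Choice of the poles and of the scale -/

theorem exists_norm_eq_one_inner_eq_zero {E : Type*} [NormedAddCommGroup E] [InnerProductSpace ℂ E]
    (hE : 2 ≤ Module.finrank ℂ E) (v : E) : ∃ u : E, ‖u‖ = 1 ∧ inner ℂ v u = 0 := by
  have hne : (ℂ ∙ v)ᗮ ≠ ⊥ := by
    intro h
    rw [Submodule.orthogonal_eq_bot_iff] at h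
    have hspan := finrank_span_le_card (R := ℂ) {v}
    rw [h, finrank_top, Set.toFinset_singleton, Finset.card_singleton] at hspan
    omega
  obtain ⟨x, hx, hx₀⟩ := Submodule.exists_mem_ne_zero_of_ne_bot hne
  refine ⟨(‖x‖⁻¹ : ℂ) • x, norm_smul_inv_norm hx₀, ?_⟩
  rw [inner_smul_right, Submodule.mem_orthogonal_singleton_iff_inner_right.1 hx, mul_zero]

theorem exists_norm_eq_one_mk_eq (p : CP N) :
    ∃ (v : HomCoord N) (hv : v ≠ 0), ‖v‖ = 1 ∧ .mk ℂ v hv = p := by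
  have hc : (‖p.rep‖⁻¹ : ℂ) ≠ 0 := by simp [p.rep_nonzero]
  refine ⟨(‖p.rep‖⁻¹ : ℂ) • p.rep, smul_ne_zero hc p.rep_nonzero,
    norm_smul_inv_norm p.rep_nonzero, ?_⟩
  conv_rhs => rw [← p.mk_rep]
  exact (Projectivization.mk_eq_mk_iff' ..).2 ⟨_, rfl⟩

theorem exists_adapted (hN : 1 ≤ N) {R ε : ℝ} (hR : 100 ≤ R) (hε : ε ≤ 1 / 100000)
    (htail : ∀ Λ : Set ℂ, Λ.Pairwise (fun a b => R ≤ dist a b) →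
      HasTailBound Λ (R / 4) (ε / 8000)) (f : ℂ → CP N) :
    ∃ D : PoleConfig N R ε, D.Adapted f := by
  have hR₀ : 0 ≤ R := by linarith
  obtain ⟨Λ, hΛ, hsep, hcover⟩ := exists_subset_separated_forall_dist_le (slowCenters R f) hR₀
  choose v hv₀ hv hvf using fun a => exists_norm_eq_one_mk_eq (f a)
  choose u hu hvu using fun a => exists_norm_eq_one_inner_eq_zero
    (by rw [finrank_euclideanSpace_fin]; omega) (v a)
  exact ⟨⟨Λ, v, u, hv, hu, hvu, hsep, htail Λ hsep, hR, hε⟩, hΛ,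
    fun z hz => by simpa only [dist_eq_norm] using hcover z hz, hvf⟩

theorem exists_scale (C : ℝ) {η : ℝ} (hη : 0 < η) :
    ∃ R ε : ℝ, 100 ≤ R ∧ ε / 8000 = C / R ^ 3 ∧ ε ≤ 1 / 100000 ∧ 4 * ε ≤ η ∧
      13 * (12 * ε + 12 / √R + 8 / R) + 208 * √R ^ 2 / R ^ 2 < η := by
  have hε : Tendsto (fun R : ℝ => 8000 * C / R ^ 3) atTop (𝓝 0) :=
    tendsto_const_nhds.div_atTop (tendsto_pow_atTop three_ne_zero)
  have herr : Tendsto (fun R : ℝ => 13 * (12 * (8000 * C / R ^ 3) + 12 / √R + 8 / R) + 208 / R)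
      atTop (𝓝 (13 * (12 * 0 + 0 + 0) + 0)) :=
    ((((hε.const_mul 12).add (tendsto_const_nhds.div_atTop Real.tendsto_sqrt_atTop)).add
      (tendsto_const_nhds.div_atTop tendsto_id)).const_mul 13).add
      (tendsto_const_nhds.div_atTop tendsto_id)
  obtain ⟨R, ⟨hR, hε₁, hε₂⟩, hlt⟩ := (((eventually_ge_atTop 100).and
    ((hε.eventually_le_const (by norm_num : (0 : ℝ) < 1 / 100000)).and
      (hε.eventually_le_const (by linarith : 0 < η / 4)))).and
    (herr.eventually_lt_const (by simpa using hη))).exists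
  have hsqrt : 208 * √R ^ 2 / R ^ 2 = 208 / R := by
    have hR₀ : R ≠ 0 := by linarith
    rw [Real.sq_sqrt (by linarith)]
    field_simp
  exact ⟨R, _, hR, by ring, hε₁, by linarith, by rwa [hsqrt]⟩

end Brody

theorem mainTheorem8 (N : ℕ) (hN : 1 ≤ N) :
    ∃ (δ₂ : ℝ) (hδ₂ : 0 < δ₂) (C₃ : ℝ), 1 < C₃ ∧
      ∀ η : ℝ, 0 < η → ∃ R₁ : ℝ, 0 < R₁ ∧
        ∀ (f : ℂ → Brody.CP N) (hf : f ∈ Brody.BrodyCurves N),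
          ∃ Φ : Brody.brodyBall δ₂ f → Brody.LipCurves N (1 + η),
            -- `Φ(f)` is nondegenerate
            Brody.IsNondegenerate R₁
              (Φ ⟨f, Brody.mem_brodyBall_self hδ₂ hf⟩ : ℂ → Brody.CP N) ∧
            -- control of distances
            (∀ (g₁ g₂ : Brody.brodyBall δ₂ f) (z : ℂ),
              Brody.dFS ((Φ g₁ : ℂ → Brody.CP N) z) ((Φ g₂ : ℂ → Brody.CP N) z) ≤
                  C₃ * Brody.dFS ((g₁ : ℂ → Brody.CP N) z) ((g₂ : ℂ → Brody.CP N) z) ∧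
                Brody.dFS ((g₁ : ℂ → Brody.CP N) z) ((g₂ : ℂ → Brody.CP N) z) ≤
                  C₃ * ⨆ w : Metric.closedBall z 3,
                    Brody.dFS ((Φ g₁ : ℂ → Brody.CP N) w) ((Φ g₂ : ℂ → Brody.CP N) w)) ∧
            (∀ g : Brody.brodyBall δ₂ f,
              Brody.dC (Φ ⟨f, Brody.mem_brodyBall_self hδ₂ hf⟩ : ℂ → Brody.CP N)
                (Φ g : ℂ → Brody.CP N) ≤ C₃ * δ₂) ∧
            -- control of energies over squares
            (∀ (a u : ℂ) (L : ℝ), ‖u‖ = 1 → R₁ ≤ L →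
              |(∫ z in Brody.square a u L, Brody.speed f z ^ 2) -
                  ∫ z in Brody.square a u L,
                    Brody.speed (Φ ⟨f, Brody.mem_brodyBall_self hδ₂ hf⟩ : ℂ → Brody.CP N) z ^ 2| <
                η * L ^ 2) := by
  obtain ⟨C, hC⟩ := Brody.exists_hasTailBound
  refine ⟨1 / 20, by norm_num, 486000000, by norm_num, fun η hη => ?_⟩
  obtain ⟨R, ε, hR, hεC, hε, hεη, hη⟩ := Brody.exists_scale C hη
  refine ⟨25 * R, by linarith, fun f hf => ?_⟩
  obtain ⟨D, hD⟩ := Brody.exists_adapted hN hR hε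
    (fun Λ hΛ => hεC ▸ hC Λ R (by linarith) hΛ) f
  have hadm (g : Brody.brodyBall (1 / 20) f) : D.Admissible g := hD.admissible hf g.2
  have hself := hadm ⟨f, Brody.mem_brodyBall_self (by norm_num) hf⟩
  have hmem (g : Brody.brodyBall (1 / 20) f) := (hadm g).deform_mem_lipCurves g.2.1
  refine ⟨fun g => ⟨D.deform g, (hmem g).1, fun z => ((hmem g).2 z).trans (by linarith)⟩,
    hD.isNondegenerate_deform hself, fun g₁ g₂ z => ⟨?_, (hadm g₁).dFS_le_iSup_deform (hadm g₂) z⟩,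
    fun g => ciSup_le fun z => ?_, fun a u L hu hL => ?_⟩
  · linarith [(hadm g₁).dFS_deform_le (hadm g₂) z,
      Brody.dFS_nonneg ((g₁ : ℂ → Brody.CP N) z) ((g₂ : ℂ → Brody.CP N) z)]
  · linarith [hself.dFS_deform_le (hadm g) z, Brody.dFS_le_dC f g z, g.2.2]
  · have hρR : √R ≤ R := Real.sqrt_le_iff.2 ⟨by linarith, by nlinarith⟩
    have : 0 < L := by linarith
    refine (hD.abs_energy_sub_le hf hself (Real.sqrt_pos.2 (by linarith)) hρR hu
      (by linarith)).trans_lt ?_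
    gcongr
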